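/- Let $k$ be a finite field with $q$ elements and $F$ a finite field extension of $k$. Let $K$ be a finite extension of $k(t)$ and $L/K$ a finite Galois extension with group $G$. Let $\mathcal O_K,\mathcal O_L$ be the integral closures of $k[t]$ in $K$ and $L$, and let $z$ be the image of $t$ in any $\mathcal O_K$-algebra. Let $\rho:G\to \mathrm{GL}_F(V)$ be a representation on a finite dimensional $F$-vector space $V$, and let $n\ge 1$ be an integer. For a field $E$ and an $E[t]$-module $M$ of finite dimension over $E$, put $|M|_{E[t]}=\det_{E[t]}(1\otimes t-t\otimes 1,\ M\otimes_E E[t])$. For an $\mathcal O_K$-algebra $B$, let $C^{\otimes n}(B)$ and $\mathrm{Lie}(C^{\otimes n})(B)$ be the $k$-vector space $B^n$ with the $k[t]$-module structures in which $t$ acts, respectively, by $$(x_1,\dots,x_n)\mapsto (zx_1+x_2,\dots,zx_{n-1}+x_n,\,zx_n+x_1^q),\qquad (x_1,\dots,x_n)\mapsto (zx_1+x_2,\dots,zx_{n-1}+x_n,\,zx_n).$$ Let $V^*=\mathrm{Hom}_F(V,F)$ with the right $F[G]$-module structure $(\varphi g)(v)=\varphi(\rho(g)v)$. For a left $k[t][G]$-module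 $M$, $V^*\otimes_{k[G]}M$ is an $F[t]$-module, with $F$ acting through $V^*$ and $t$ through $M$. For every maximal ideal $\mathfrak p$ of $\mathcal O_K$, with residue field $\kappa_{\mathfrak p}$, choose a prime ideal $\mathfrak P$ of $\mathcal O_L$ above $\mathfrak p$. Let $I_{\mathfrak P}$ be its inertia group, and let $\mathrm{Frob}_{\mathfrak P}$ be the Frobenius element of the quotient of the decomposition group by $I_{\mathfrak P}$, which acts on $\kappa_{\mathfrak P}=\mathcal O_L/\mathfrak P$ by $x\mapsto x^{|\kappa_{\mathfrak p}|}$. Define $$L(n,\rho)=\prod_{\mathfrak p\in \mathrm{Max}(\mathcal O_K)}\det\Big(1-\frac{\rho(\mathrm{Frob}_{\mathfrak P})}{|\kappa_{\mathfrak p}|_{k[t]}^{\,n}},\ V^{I_{\mathfrak P}}((t^{-1}))\Big)^{-1}\in F((t^{-1})).$$ Then, for every choice of the primes $\mathfrak P$, the $F$-vector spaces $V^*\otimes_{k[G]}(\mathcal O_L/\mathfrak p\mathcal O_L)^n$ are finite, the product defining $L(n,\rho)$ and the product on the right hand side below converge unconditionally in the $t^{-1}$-adic topology of $F((t^{-1}))$,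 and $$L(n,\rho)=\prod_{\mathfrak p\in \mathrm{Max}(\mathcal O_K)}\frac{\big|V^*\otimes_{k[G]}\mathrm{Lie}(C^{\otimes n})(\mathcal O_L/\mathfrak p\mathcal O_L)\big|_{F[t]}}{\big|V^*\otimes_{k[G]}C^{\otimes n}(\mathcal O_L/\mathfrak p\mathcal O_L)\big|_{F[t]}}\ \in\ 1+t^{-1}F[[t^{-1}]].$$ -/

import Mathlib

open scoped Polynomial TensorProduct

noncomputable section

namespace CarlitzArtin

/-! ### Characteristic polynomials of finite modules over `F[t]` -/

section CharPoly

variable {F M : Type*} [Field F] [AddCommGroup M] [Module F M]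

/-- An `F[t]`-module structure on the `F`-vector space `M`, compatible with the scalars, is an
`F`-algebra map `θ : F[t] → End_F(M)`. For such a module of finite dimension over `F`,
`charPoly θ` is `|M|_{F[t]} = det_{F[t]} (1 ⊗ t - t ⊗ 1, M ⊗_F F[t])`. (The factors of the tensor
product are written in the other order here.) -/
def charPoly (θ : F[X] →ₐ[F] Module.End F M) : F[X] :=
  LinearMap.det ((Polynomial.X : F[X]) • (LinearMap.id : F[X] ⊗[F] M →ₗ[F[X]] F[X] ⊗[F] M) -
    (θ Polynomial.X).baseChange F[X])

/-- The embedding `F[t] → F((t⁻¹))`. Here `F((t⁻¹))` is the field of Laurent series over `F` whose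
variable stands for `t⁻¹`, so that `t` goes to the monomial of exponent `-1`. -/
def toLaurent (F : Type*) [Field F] : F[X] →ₐ[F] LaurentSeries F :=
  Polynomial.aeval (HahnSeries.single (-1 : ℤ) (1 : F) : LaurentSeries F)

end CharPoly

/-! ### Tensor powers of the Carlitz module -/

section Carlitz

variable (k : Type*) [Field k] [Fintype k] (n : ℕ) [NeZero n]
variable (B : Type*) [CommRing B] [Algebra k B] [Algebra k[X] B] [IsScalarTower k k[X] B]

/-- The operator `(x₁, …, xₙ) ↦ (z x₁ + x₂, …, z xₙ₋₁ + xₙ, z xₙ)` on `Bⁿ`, where `z` is the image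
of `t` in `B`. -/
def lieT : (Fin n → B) →ₗ[k] (Fin n → B) where
  toFun x i := algebraMap k[X] B Polynomial.X * x i +
    if h : i.1 + 1 < n then x ⟨i.1 + 1, h⟩ else 0
  map_add' x y := by
    funext i
    by_cases h : i.1 + 1 < n <;> simp [h] <;> ring
  map_smul' c x := by
    funext i
    by_cases h : i.1 + 1 < n <;> simp [h, smul_add]

/-- The operator `(x₁, …, xₙ) ↦ (z x₁ + x₂, …, z xₙ₋₁ + xₙ, z xₙ + x₁ ^ q)` on `Bⁿ`, where `z` is
the image of `t` in `B` and `q` is the cardinality of `k`. -/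
def carlitzT : (Fin n → B) →ₗ[k] (Fin n → B) where
  toFun x i := algebraMap k[X] B Polynomial.X * x i +
    if h : i.1 + 1 < n then x ⟨i.1 + 1, h⟩ else x 0 ^ Fintype.card k
  map_add' x y := by
    funext i
    by_cases h : i.1 + 1 < n
    · simp [h]; ring
    · have := map_add (FiniteField.frobeniusAlgHom k B) (x 0) (y 0)
      simp only [FiniteField.coe_frobeniusAlgHom] at this
      simp [h, this]; ring
  map_smul' c x := by
    funext i
    by_cases h : i.1 + 1 < n
    · simp [h, smul_add]
    · have := map_smul (FiniteField.frobeniusAlgHom k B) c (x 0)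
      simp only [FiniteField.coe_frobeniusAlgHom] at this
      simp [h, smul_add, this]

/-- The `k[t]`-module `C^{⊗n}(B)`: the `k`-vector space `Bⁿ` with the structure map
`k[t] → End_k(Bⁿ)` under which `t` acts by `carlitzT`. -/
def carlitz : k[X] →ₐ[k] Module.End k (Fin n → B) := Polynomial.aeval (carlitzT k n B)

/-- The `k[t]`-module `Lie(C^{⊗n})(B)`: the `k`-vector space `Bⁿ` with the structure map
`k[t] → End_k(Bⁿ)` under which `t` acts by `lieT`, the linear part of `carlitzT`. -/
def lie : k[X] →ₐ[k] Module.End k (Fin n → B) := Polynomial.aeval (lieT k n B)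

variable {G : Type*} [Group G] [MulSemiringAction G B] [SMulCommClass G k[X] B]

theorem smul_algebraMap_mul (g : G) (a : k[X]) (b : B) :
    g • (algebraMap k[X] B a * b) = algebraMap k[X] B a * g • b := by
  rw [← Algebra.smul_def, smul_comm, Algebra.smul_def]

/-- Ring automorphisms of `B` over `k[t]`, acting on `Bⁿ` coordinatewise, are
`k[t]`-linear for `C^{⊗n}(B)`. -/
theorem carlitz_smul (g : G) (x : Fin n → B) :
    carlitz k n B Polynomial.X (g • x) = g • carlitz k n B Polynomial.X x := by
  funext i
  simp only [carlitz, Polynomial.aeval_X, carlitzT, LinearMap.coe_mk, AddHom.coe_mk, Pi.smul_apply,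
    smul_add, smul_algebraMap_mul]
  split_ifs <;> simp [smul_pow']

/-- Ring automorphisms of `B` over `k[t]`, acting on `Bⁿ` coordinatewise, are
`k[t]`-linear for `Lie(C^{⊗n})(B)`. -/
theorem lie_smul (g : G) (x : Fin n → B) :
    lie k n B Polynomial.X (g • x) = g • lie k n B Polynomial.X x := by
  funext i
  simp only [lie, Polynomial.aeval_X, lieT, LinearMap.coe_mk, AddHom.coe_mk, Pi.smul_apply,
    smul_add, smul_algebraMap_mul]
  split_ifs <;> simp

end Carlitz

/-! ### The tensor product of a right and a left `k[G]`-module -/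

section BalancedTensor

variable (k : Type*) [Field k] {F : Type*} [Field F] [Algebra k F] {G : Type*} [Group G]

/-- The right `F[G]`-module structure `(φ g)(v) = φ (ρ(g) v)` on `V* = Hom_F(V, F)`. -/
def dualRight {V : Type*} [AddCommGroup V] [Module F V] (ρ : Representation F G V) :
    Representation F Gᵐᵒᵖ (Module.Dual F V) where
  toFun g := (ρ g.unop).dualMap
  map_one' := by ext; simp
  map_mul' g h := by ext; simp

variable {N : Type*} [AddCommGroup N] [Module F N] [Module k N] [IsScalarTower k F N]
  (r : Representation F Gᵐᵒᵖ N)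
variable (M : Type*) [AddCommGroup M] [Module k M] [DistribMulAction G M]

/-- The relations `x g ⊗ m = x ⊗ g m` which cut out `N ⊗_{k[G]} M` as a quotient of
`N ⊗_k M`, for a right `F[G]`-module `N` (that is, a representation of the opposite group) and a
left `k[G]`-module `M`. -/
def balancedRel : Submodule F (N ⊗[k] M) :=
  Submodule.span F {y | ∃ (x : N) (g : G) (m : M),
    y = (r (MulOpposite.op g) x) ⊗ₜ[k] m - x ⊗ₜ[k] (g • m)}

/-- The `F`-vector space `N ⊗_{k[G]} M`, for a right `F[G]`-module `N` and a left
`k[G]`-module `M`. -/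
abbrev BalancedTensor : Type _ := (N ⊗[k] M) ⧸ balancedRel k r M

variable {M}

/-- A `k[t][G]`-module structure on `M`, given by a `k`-algebra map `θ : k[t] → End_k(M)` such that
`t` commutes with the elements of `G`, makes `N ⊗_{k[G]} M` into an `F[t]`-module: `F` acts
through `N`, and `t` acts through `M`. -/
def balancedTensorAction (θ : k[X] →ₐ[k] Module.End k M)
    (hθ : ∀ (g : G) (m : M), θ Polynomial.X (g • m) = g • θ Polynomial.X m) :
    F[X] →ₐ[F] Module.End F (BalancedTensor k r M) :=
  Polynomial.aeval ((balancedRel k r M).mapQ (balancedRel k r M)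
    (TensorProduct.AlgebraTensorModule.map (LinearMap.id : N →ₗ[F] N) (θ Polynomial.X))
    (by
      refine Submodule.span_le.mpr ?_
      rintro _ ⟨x, g, m, rfl⟩
      refine Submodule.subset_span ⟨x, g, θ Polynomial.X m, ?_⟩
      simp [hθ]))

end BalancedTensor

/-! ### Galois actions on integral closures and their reductions -/

section Reduction

variable {A B G : Type*} [CommRing A] [CommRing B] [Algebra A B] [Group G] [MulSemiringAction G B]
  [SMulCommClass G A B]

theorem map_le_comap (p : Ideal A) (g : G) : p.map (algebraMap A B) ≤
    (p.map (algebraMap A B)).comap (MulSemiringAction.toRingHom G B g) := by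
  refine Ideal.map_le_iff_le_comap.mpr fun a ha => ?_
  simp only [Ideal.mem_comap, MulSemiringAction.toRingHom_apply, smul_algebraMap]
  exact Ideal.mem_map_of_mem _ ha

/-- If `G` acts on the `A`-algebra `B`, then it acts on `B/pB` for every ideal `p` of `A`. -/
instance reductionAction (p : Ideal A) : MulSemiringAction G (B ⧸ p.map (algebraMap A B)) where
  smul g := Ideal.quotientMap _ (MulSemiringAction.toRingHom G B g) (map_le_comap p g)
  one_smul x := by
    obtain ⟨x, rfl⟩ := Ideal.Quotient.mk_surjective x
    exact congrArg (Ideal.Quotient.mk _) (one_smul G x)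
  mul_smul g h x := by
    obtain ⟨x, rfl⟩ := Ideal.Quotient.mk_surjective x
    exact congrArg (Ideal.Quotient.mk _) (mul_smul g h x)
  smul_zero g := map_zero (Ideal.quotientMap _ _ (map_le_comap p g))
  smul_add g := map_add (Ideal.quotientMap _ _ (map_le_comap p g))
  smul_one g := map_one (Ideal.quotientMap _ _ (map_le_comap p g))
  smul_mul g := map_mul (Ideal.quotientMap _ _ (map_le_comap p g))

theorem reductionAction_mk (p : Ideal A) (g : G) (b : B) :
    g • Ideal.Quotient.mk (p.map (algebraMap A B)) b = Ideal.Quotient.mk _ (g • b) := rfl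

instance reductionAction_smulCommClass {R : Type*} [CommRing R] [Algebra R B]
    [SMulCommClass G R B] (p : Ideal A) :
    SMulCommClass G R (B ⧸ p.map (algebraMap A B)) where
  smul_comm g r x := by
    obtain ⟨x, rfl⟩ := Ideal.Quotient.mk_surjective x
    exact congrArg (Ideal.Quotient.mk _) (smul_comm g r x)

end Reduction

section IntegralClosure

variable (k K L : Type*) [Field k] [Field K] [Field L] [Algebra k[X] K] [Algebra k[X] L]
  [Algebra K L] [IsScalarTower k[X] K L]

/-- The integral closure `𝒪_K` of `k[t]` in `K`. -/
abbrev IntClosure : Type _ := integralClosure k[X] K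

instance intClosureAlgebra : Algebra (IntClosure k K) (IntClosure k L) :=
  (IsScalarTower.toAlgHom k[X] K L).mapIntegralClosure.toRingHom.toAlgebra

instance intClosure_smulCommClass :
    SMulCommClass Gal(L/K) (IntClosure k K) (IntClosure k L) where
  smul_comm g a b := by
    apply Subtype.ext
    change g (algebraMap K L a * b) = algebraMap K L a * g b
    simp

variable {k K}

/-- The ring `𝒪_L / p 𝒪_L`. -/
abbrev Reduction (p : MaximalSpectrum (IntClosure k K)) : Type _ :=
  IntClosure k L ⧸ p.asIdeal.map (algebraMap (IntClosure k K) (IntClosure k L))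

/-- The residue field `κ_p = 𝒪_K / p`. -/
abbrev ResidueField (p : MaximalSpectrum (IntClosure k K)) : Type _ :=
  IntClosure k K ⧸ p.asIdeal

/-- A prime ideal `P` of `𝒪_L` above `p`, together with an element `frob` of `Gal(L/K)` which lies
in the decomposition group of `P` and represents the Frobenius element of the quotient by the
inertia group: `frob x ≡ x ^ |κ_p|` modulo `P` for all `x` in `𝒪_L`. -/
structure FrobeniusAt (p : MaximalSpectrum (IntClosure k K)) where
  P : Ideal (IntClosure k L)
  isPrime : P.IsPrime
  liesOver : P.LiesOver p.asIdeal
  frob : Gal(L/K)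
  isFrob : IsArithFrobAt (IntClosure k K) frob P

end IntegralClosure

section Existence

variable {k K L : Type*} [Field k] [Finite k] [Field K] [Field L]
    [Algebra (RatFunc k) K] [Algebra k[X] K] [Algebra K L] [Algebra k[X] L]

/-- The residue fields of `𝒪_L` are finite. -/
theorem finite_residueField (K : Type*) [Field K] [Algebra (RatFunc k) K] [Algebra k[X] K]
    [Algebra K L] [FiniteDimensional (RatFunc k) K] [FiniteDimensional K L]
    [IsScalarTower k[X] (RatFunc k) K] [IsScalarTower k[X] K L] (P : Ideal (IntClosure k L)) [P.IsMaximal] :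
    Finite (IntClosure k L ⧸ P) := by
  let : Algebra (RatFunc k) L := ((algebraMap K L).comp (algebraMap (RatFunc k) K)).toAlgebra
  have : IsScalarTower (RatFunc k) K L := .of_algebraMap_eq fun _ => rfl
  have : IsScalarTower k[X] (RatFunc k) L := .of_algebraMap_eq fun x => by
    rw [IsScalarTower.algebraMap_apply k[X] K L, IsScalarTower.algebraMap_apply k[X] (RatFunc k) K]
    rfl
  have : FiniteDimensional (RatFunc k) L := FiniteDimensional.trans _ K L
  have : IsFractionRing (IntClosure k L) L := integralClosure.isFractionRing_of_finite_extension (RatFunc k) L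
  let p : Ideal k[X] := P.comap (algebraMap k[X] (IntClosure k L))
  have : p.IsMaximal := Ideal.isMaximal_comap_of_isIntegral_of_isMaximal P
  have hp0 : p ≠ ⊥ := by
    intro h
    have : P = ⊥ := Ideal.eq_bot_of_comap_eq_bot (R := k[X]) h
    have hm : (⊥ : Ideal k[X]).IsMaximal := h ▸ inferInstance
    exact Polynomial.not_isField k (Ring.isField_iff_maximal_bot.mpr hm)
  let : Algebra (k[X] ⧸ p) (IntClosure k L ⧸ P) := Ideal.Quotient.algebraQuotientOfLEComap le_rfl
  let : Field (k[X] ⧸ p) := Ideal.Quotient.field p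
  have : Finite (k[X] ⧸ p) := by
    obtain ⟨f, hf⟩ := (IsPrincipalIdealRing.principal p).principal
    have hf0 : f ≠ 0 := by rintro rfl; apply hp0; rw [hf]; simp
    have hp : p = Ideal.span {f} := hf
    rw [hp]
    have : Module.Finite k (AdjoinRoot f) := (AdjoinRoot.powerBasis hf0).finite
    exact (Module.finite_of_finite k : Finite (AdjoinRoot f))
  have : Module.Free (k[X] ⧸ p) (IntClosure k L ⧸ P) := Module.Free.of_divisionRing _ _
  have : Module.Finite (k[X] ⧸ p) (IntClosure k L ⧸ P) := by
    let b := Module.Free.chooseBasis (k[X] ⧸ p) (IntClosure k L ⧸ P)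
    let b' := fun i => (Ideal.Quotient.mk_surjective (b i)).choose
    have e : ⇑b = ((Submodule.mkQ P).restrictScalars k[X]) ∘ b' :=
      funext fun i => (Ideal.Quotient.mk_surjective (b i)).choose_spec.symm
    have hb := b.linearIndependent
    rw [e] at hb
    have : IsScalarTower k[X] (k[X] ⧸ p) (IntClosure k L ⧸ P) := .of_algebraMap_eq fun _ => rfl
    have := Ideal.FinrankQuotientMap.linearIndependent_of_nontrivial (S := k[X] ⧸ p) (RatFunc k) (by
      rw [Ideal.Quotient.algebraMap_eq, Ideal.mk_ker]; exact Ideal.IsPrime.ne_top inferInstance)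
      ((Algebra.linearMap (IntClosure k L) L).restrictScalars k[X]) (fun _ _ h => Subtype.ext h) _ hb
    have := this.finite
    exact Module.Finite.of_basis b
  exact Module.finite_of_finite (k[X] ⧸ p)

/-- Above every maximal ideal of `𝒪_K` there are a prime ideal and a Frobenius element. -/
theorem nonempty_frobeniusAt [FiniteDimensional (RatFunc k) K] [FiniteDimensional K L]
    [IsGalois K L] [IsScalarTower k[X] (RatFunc k) K] [IsScalarTower k[X] K L]
    (p : MaximalSpectrum (IntClosure k K)) : Nonempty (FrobeniusAt L p) := by
  have tow : ∀ a : IntClosure k K, ((algebraMap (IntClosure k K) (IntClosure k L) a : IntClosure k L) : L) = algebraMap K L a := fun _ => rfl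
  have : IsScalarTower k[X] (IntClosure k K) (IntClosure k L) := .of_algebraMap_eq fun x => by
    apply Subtype.ext
    rw [tow]; exact IsScalarTower.algebraMap_apply k[X] K L x
  have : Algebra.IsIntegral (IntClosure k K) (IntClosure k L) := Algebra.IsIntegral.tower_top k[X]
  have : FaithfulSMul (IntClosure k K) (IntClosure k L) := by
    rw [faithfulSMul_iff_algebraMap_injective]
    intro a b h
    apply Subtype.ext
    exact (algebraMap K L).injective (congrArg Subtype.val h)
  have := p.isMaximal
  obtain ⟨P, hP, hl⟩ := Ideal.exists_maximal_ideal_liesOver_of_isIntegral (S := IntClosure k L) p.asIdeal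
  have : Algebra.IsInvariant (IntClosure k K) (IntClosure k L) Gal(L/K) := ⟨fun b hb => by
    obtain ⟨a, ha⟩ := (IsGalois.mem_bot_iff_fixed (F := K) (b : L)).mpr fun g => congrArg Subtype.val (hb g)
    have hi : IsIntegral k[X] a := by
      rw [← isIntegral_algebraMap_iff (algebraMap K L).injective]
      have := b.2; rw [← ha] at this; exact this
    exact ⟨⟨a, hi⟩, Subtype.ext ha⟩⟩
  have := finite_residueField K P
  obtain ⟨σ, hσ⟩ := IsArithFrobAt.exists_of_isInvariant (IntClosure k K) Gal(L/K) P
  exact ⟨⟨P, hP.isPrime, hl, σ, hσ⟩⟩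

end Existence

/-! ### The Artin `L`-value -/

section LValue

variable {k K L F V : Type*} [Field k] [Field K] [Field L] [Field F]
  [Algebra k K] [Algebra k[X] K] [IsScalarTower k k[X] K] [Algebra k[X] L]
  [Algebra K L] [IsScalarTower k[X] K L] [Algebra k F] [AddCommGroup V] [Module F V]

/-- `|κ_p|_{k[t]}`, viewed in `F[t]`. -/
def residueCharPoly (F : Type*) [Field F] [Algebra k F] (p : MaximalSpectrum (IntClosure k K)) :
    F[X] :=
  (charPoly ((Algebra.lsmul k k (ResidueField p)).comp
    (IsScalarTower.toAlgHom k k[X] (ResidueField p)))).map (algebraMap k F)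

variable (ρ : Representation F Gal(L/K) V) {p : MaximalSpectrum (IntClosure k K)}

/-- The invariants `V^{I_P}` of the inertia group. -/
def inertiaInvariants (c : FrobeniusAt L p) : Submodule F V :=
  Representation.invariants (ρ.comp (c.P.inertia Gal(L/K)).subtype)

theorem mem_inertiaInvariants (c : FrobeniusAt L p) (v : V) :
    v ∈ inertiaInvariants ρ c ↔ ∀ g ∈ c.P.inertia Gal(L/K), ρ g v = v := by
  rw [inertiaInvariants, Representation.mem_invariants, Subtype.forall]
  rfl

open scoped Pointwise in
theorem frob_mem_inertiaInvariants (c : FrobeniusAt L p) (v : V)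
    (hv : v ∈ inertiaInvariants ρ c) : ρ c.frob v ∈ inertiaInvariants ρ c := by
  rw [mem_inertiaInvariants] at hv ⊢
  intro g hg
  have := c.isPrime
  have hs : c.frob ∈ MulAction.stabilizer Gal(L/K) c.P := c.isFrob.mem_stabilizer
  have hmem : c.frob⁻¹ * g * c.frob ∈ c.P.inertia Gal(L/K) := by
    intro x
    have h1 := hg (c.frob • x)
    rw [Submodule.mem_toAddSubgroup] at h1 ⊢
    have h2 := Ideal.smul_mem_pointwise_smul c.frob⁻¹ _ _ h1
    rw [(inv_mem hs : c.frob⁻¹ ∈ MulAction.stabilizer Gal(L/K) c.P)] at h2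
    simpa [smul_sub, mul_smul] using h2
  have h := hv _ hmem
  have h' := congrArg (ρ c.frob) h
  rwa [← Module.End.mul_apply, ← map_mul, mul_assoc, mul_inv_cancel_left, map_mul,
    Module.End.mul_apply] at h'

/-- The operator `ρ(Frob_P)` on `V^{I_P}`. -/
def frobOnInvariants (c : FrobeniusAt L p) :
    inertiaInvariants ρ c →ₗ[F] inertiaInvariants ρ c :=
  (ρ c.frob).restrict (frob_mem_inertiaInvariants ρ c)

/-- The Euler factor `det (1 - ρ(Frob_P) / |κ_p|_{k[t]} ^ n, V^{I_P})⁻¹` in `F((t⁻¹))`. -/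
def eulerFactor (n : ℕ) (c : FrobeniusAt L p) : LaurentSeries F :=
  (LinearMap.det (LinearMap.id - ((toLaurent F (residueCharPoly F p)) ^ n)⁻¹ •
    (frobOnInvariants ρ c).baseChange (LaurentSeries F)))⁻¹

/-- The value `L(n, ρ)`, the product of the Euler factors over the maximal ideals of `𝒪_K` in
`F((t⁻¹))` with its `t⁻¹`-adic topology. It is computed from a choice of a prime and of a Frobenius
element over every maximal ideal of `𝒪_K`. -/
def artinLValue (n : ℕ) (c : ∀ p : MaximalSpectrum (IntClosure k K), FrobeniusAt L p) :
    LaurentSeries F :=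
  ∏' p, eulerFactor ρ n (c p)

variable [Fintype k] [Algebra k L] [IsScalarTower k k[X] L]

/-- `|V* ⊗_{k[G]} C^{⊗n}(𝒪_L / p 𝒪_L)|_{F[t]}`. -/
def carlitzCharPoly (n : ℕ) [NeZero n] (p : MaximalSpectrum (IntClosure k K)) : F[X] :=
  charPoly (balancedTensorAction k (dualRight ρ) (carlitz k n (Reduction L p)) (carlitz_smul k n (Reduction L p)))

/-- `|V* ⊗_{k[G]} Lie(C^{⊗n})(𝒪_L / p 𝒪_L)|_{F[t]}`. -/
def lieCharPoly (n : ℕ) [NeZero n] (p : MaximalSpectrum (IntClosure k K)) : F[X] :=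
  charPoly (balancedTensorAction k (dualRight ρ) (lie k n (Reduction L p)) (lie_smul k n (Reduction L p)))

/-- The ratio of `|V* ⊗_{k[G]} Lie(C^{⊗n})(𝒪_L / p 𝒪_L)|_{F[t]}` by
`|V* ⊗_{k[G]} C^{⊗n}(𝒪_L / p 𝒪_L)|_{F[t]}`, in `F((t⁻¹))`. -/
def localRatio (n : ℕ) [NeZero n] (p : MaximalSpectrum (IntClosure k K)) : LaurentSeries F :=
  toLaurent F (lieCharPoly ρ n p) / toLaurent F (carlitzCharPoly ρ n p)

end LValue

end CarlitzArtin

end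

/-!
The two products agree factor by factor: for every maximal ideal `p` of `𝒪_K` and every choice of a
prime `P` above `p` with a Frobenius element, the ratio of `|V* ⊗ Lie(C^{⊗n})(R)|` by
`|V* ⊗ C^{⊗n}(R)|`, where `R = 𝒪_L / p 𝒪_L`, is the Euler factor at `p`
(`localRatio_eq_eulerFactor`). No hypothesis on the ramification enters.

Write `W = V* ⊗_{k[G]} R`, let `z` and `τ` be the operators on `W` induced by multiplication by `t`
and by the `q`-power map of `R`, and let `d` be the degree of `κ = 𝒪_K / p` over `k`. The two
actions of `t` on `W ^ n` differ only by `τ` in one corner, and solving the bidiagonal system that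
belongs to the action on the Lie algebra gives the ratio of the characteristic polynomial of
`C^{⊗n}` by the one of `Lie(C^{⊗n})` as `det (1 - (t - z) ^ (-n) τ)` (`aeval_charPoly_carlitz`).

The relation `τ z = z ^ q τ` makes it possible to remove `z`. Over an algebraic closure, let `c` be a
suitable `d`-th root of `|κ| ^ (-n)`. A polynomial `U`, found by Lagrange interpolation at the
conjugates of `z`, satisfies `U(z) (t - z) ^ (-n) τ = c τ U(z)`, so the determinant is
`det (1 - c τ)` (`exists_det_one_sub_comp_eq`).

It remains to find the characteristic polynomial of `τ`, or of its transpose. The dual of `W` is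
`Hom_{k[G]}(R, V)`, on which the transpose of `τ` is precomposition with the `q`-power map. This
operator is nilpotent modulo the subspace of the maps which vanish on the nilradical of `R`. By
transitivity of `G` on the primes above `p`, a map in this subspace is determined by a map from the
residue field of `P` to `V`, equivariant for the decomposition group; and by the normal basis
theorem over `k` it is given by its values, which are arbitrary elements of `V ^ I`, on `d`
consecutive `q`-power conjugates of a normal generator. In these coordinates the operator is the
shift `(h₀, …, h_{d-1}) ↦ (h₁, …, h_{d-1}, Frob h₀)`
(`ResidueData.exists_cyclicShift_embedding`), and the determinant of `1 - c` times this shift is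
`det (1 - c ^ d Frob) = det (1 - |κ| ^ (-n) Frob)` on `V ^ I` (`det_one_sub_smul_cyclicShift`).

For the convergence, the Euler factor at `p` is a power series in `t⁻¹` congruent to `1` modulo
`t ^ (-d)` (`exists_eulerFactor_eq`), and there are finitely many `p` of bounded residue degree,
since the nonzero ideals of `𝒪_K` have finite index (`hasFiniteQuotients_intClosure`).
-/

noncomputable section

namespace CarlitzArtin

/-! ### Determinants of `1 - c f` -/

section Determinants

variable {E : Type*} [Field E] {M N : Type*} [AddCommGroup M] [Module E M] [AddCommGroup N]
  [Module E N] [FiniteDimensional E M] [FiniteDimensional E N]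

/-- The Weinstein–Aronszajn identity for linear maps. -/
theorem det_one_sub_comp_comm (f : M →ₗ[E] N) (g : N →ₗ[E] M) :
    LinearMap.det (1 - f ∘ₗ g) = LinearMap.det (1 - g ∘ₗ f) := by
  let bM := Module.finBasis E M
  let bN := Module.finBasis E N
  rw [← LinearMap.det_toMatrix bN, ← LinearMap.det_toMatrix bM, map_sub, map_sub,
    LinearMap.toMatrix_one, LinearMap.toMatrix_one, LinearMap.toMatrix_comp bN bM bN,
    LinearMap.toMatrix_comp bM bN bM, Matrix.det_one_sub_mul_comm]

/-- The determinant of a perturbation of `Φ` which factors through a space `N`, in terms of a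
solution `S` of `Φ S = ι`. -/
theorem det_sub_comp_comp {Φ : Module.End E M} {ι S : N →ₗ[E] M} (h : Φ ∘ₗ S = ι)
    (τ : Module.End E N) (π : M →ₗ[E] N) :
    LinearMap.det (Φ - ι ∘ₗ τ ∘ₗ π) = LinearMap.det Φ * LinearMap.det (1 - (π ∘ₗ S) ∘ₗ τ) := by
  have : Φ - ι ∘ₗ τ ∘ₗ π = Φ ∘ₗ (1 - (S ∘ₗ τ) ∘ₗ π) := by
    rw [LinearMap.comp_sub, ← h]
    rfl
  rw [this, LinearMap.det_comp, det_one_sub_comp_comm]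
  rfl

theorem det_one_sub_of_isNilpotent {f : Module.End E M} (hf : IsNilpotent f) :
    LinearMap.det (1 - f) = 1 := by
  have h := LinearMap.eval_charpoly f 1
  rw [hf.charpoly_eq_X_pow_finrank] at h
  simpa using h.symm

/-- If `s` is the restriction of `f` along the injection `Γ`, and `f` is nilpotent modulo the image
of `Γ`, then `1 - f` and `1 - s` have the same determinant. -/
theorem det_one_sub_of_injective {Γ : N →ₗ[E] M} (hΓ : Function.Injective Γ) {s : Module.End E N}
    {f : Module.End E M} (hs : Γ ∘ₗ s = f ∘ₗ Γ) {m : ℕ} (hf : ∀ x, (f ^ m) x ∈ LinearMap.range Γ) :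
    LinearMap.det (1 - f) = LinearMap.det (1 - s) := by
  have hmap (y : N) : f (Γ y) = Γ (s y) := (LinearMap.congr_fun hs y).symm
  have hfW : LinearMap.range Γ ≤ (LinearMap.range Γ).comap f := by
    rintro _ ⟨y, rfl⟩
    exact ⟨s y, (hmap y).symm⟩
  have hW : LinearMap.range Γ ≤ (LinearMap.range Γ).comap (1 - f) := fun x hx =>
    sub_mem hx (hfW hx)
  rw [LinearMap.det_eq_det_mul_det _ (1 - f) hW]
  have h1 : (LinearMap.range Γ).mapQ _ (1 - f) hW = 1 - (LinearMap.range Γ).mapQ _ f hfW := by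
    ext x
    rfl
  have h2 : IsNilpotent ((LinearMap.range Γ).mapQ _ f hfW) := by
    refine ⟨m, ?_⟩
    rw [← Submodule.mapQ_pow]
    ext x
    simpa [Submodule.mapQ_apply] using (Submodule.Quotient.mk_eq_zero _).mpr (hf x)
  rw [h1, det_one_sub_of_isNilpotent h2, mul_one]
  rw [← LinearMap.det_conj (1 - s) (LinearEquiv.ofInjective Γ hΓ)]
  congr 1
  ext x
  obtain ⟨_, y, rfl⟩ := x
  have : (LinearEquiv.ofInjective Γ hΓ).symm ⟨Γ y, y, rfl⟩ = y :=
    (LinearEquiv.symm_apply_eq _).mpr rfl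
  simp [this, hmap]

/-- The determinant of a block companion operator on `M = N ^ n`. Here `κ j` is the inclusion of the
`j`-th copy of `N`, counted from `1`, and `π` is the first projection; `Φ` is block bidiagonal with
`y` on the diagonal and `-1` above it, and the perturbation by `τ` fills the last corner. -/
theorem det_companion {Φ : Module.End E M} {κ : ℕ → N →ₗ[E] M} {π : M →ₗ[E] N}
    {y a : Module.End E N} {n : ℕ} (hn : 0 < n) (h0 : κ 0 = 0)
    (hΦ : ∀ j < n, Φ ∘ₗ κ (j + 1) = κ (j + 1) ∘ₗ y - κ j) (hy : y * a = 1)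
    (hπ : π ∘ₗ κ 1 = 1) (hπ' : ∀ j < n, j ≠ 0 → π ∘ₗ κ (j + 1) = 0) (τ : Module.End E N) :
    LinearMap.det (Φ - κ n ∘ₗ τ ∘ₗ π) = LinearMap.det Φ * LinearMap.det (1 - a ^ n * τ) := by
  let S : N →ₗ[E] M := ∑ j ∈ Finset.range n, κ (j + 1) ∘ₗ (a ^ (n - j) : Module.End E N)
  have hS : Φ ∘ₗ S = κ n := by
    have h : ∀ j ∈ Finset.range n, Φ ∘ₗ κ (j + 1) ∘ₗ (a ^ (n - j) : Module.End E N) =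
        κ (j + 1) ∘ₗ (a ^ (n - (j + 1)) : Module.End E N) -
          κ j ∘ₗ (a ^ (n - j) : Module.End E N) := fun j hj => by
      have hj' := Finset.mem_range.mp hj
      have hpow : y ∘ₗ (a ^ (n - j) : Module.End E N) = a ^ (n - (j + 1)) := by
        rw [show n - j = n - (j + 1) + 1 by lia, pow_succ', ← Module.End.mul_eq_comp, ← mul_assoc,
          hy, one_mul]
      rw [← LinearMap.comp_assoc, hΦ j hj', LinearMap.sub_comp, LinearMap.comp_assoc, hpow]
    have hsum : Φ ∘ₗ S = ∑ j ∈ Finset.range n, Φ ∘ₗ κ (j + 1) ∘ₗ (a ^ (n - j) : Module.End E N) := by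
      ext x
      simp [S]
    rw [hsum, Finset.sum_congr rfl h,
      Finset.sum_range_sub (fun j => κ j ∘ₗ (a ^ (n - j) : Module.End E N)), h0]
    ext x
    simp
  rw [det_sub_comp_comp hS]
  congr 3
  have hsum : π ∘ₗ S = ∑ j ∈ Finset.range n, (π ∘ₗ κ (j + 1)) ∘ₗ (a ^ (n - j) : Module.End E N) := by
    ext x
    simp [S]
  rw [hsum, Finset.sum_eq_single_of_mem 0 (Finset.mem_range.mpr hn), zero_add, hπ, Nat.sub_zero]
  · rfl
  · intro j hj hj0
    rw [hπ' j (Finset.mem_range.mp hj) hj0, LinearMap.zero_comp]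

end Determinants

section BaseChange

variable {F : Type*} [Field F] {M N : Type*} [AddCommGroup M] [Module F M] [AddCommGroup N]
  [Module F N] [FiniteDimensional F M] [FiniteDimensional F N]

theorem charPoly_eq_charpoly (θ : F[X] →ₐ[F] Module.End F M) :
    charPoly θ = (θ Polynomial.X).charpoly := by
  let b := Module.finBasis F M
  rw [charPoly, ← LinearMap.det_toMatrix (b.baseChange F[X]), ← LinearMap.charpoly_toMatrix _ b,
    Matrix.charpoly]
  congr 1
  ext i j : 1
  by_cases h : i = j <;>
    simp [LinearMap.toMatrix_apply, h, Algebra.smul_def]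

theorem charpoly_dualMap (f : Module.End F M) :
    LinearMap.charpoly (f.dualMap : Module.End F (Module.Dual F M)) = f.charpoly := by
  let b := Module.finBasis F M
  rw [← LinearMap.charpoly_toMatrix f b, ← LinearMap.charpoly_toMatrix _ b.dualBasis,
    ← Matrix.charpoly_transpose]
  congr 1
  exact (congrArg Matrix.transpose (LinearMap.toMatrix_transpose f)).trans
    (Matrix.transpose_transpose _)

variable (E : Type*) [Field E] [Algebra F E]

theorem det_smul_sub_baseChange (f : Module.End F M) (x : E) :
    LinearMap.det (x • (1 : Module.End E (E ⊗[F] M)) - f.baseChange E) =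
      Polynomial.aeval x f.charpoly := by
  rw [Polynomial.aeval_def, Polynomial.eval₂_eq_eval_map, ← LinearMap.charpoly_baseChange,
    LinearMap.eval_charpoly, Algebra.algebraMap_eq_smul_one]

/-- `det (1 - c f)` is the value at `c` of the reverse characteristic polynomial of `f`. -/
theorem det_one_sub_smul_baseChange (f : Module.End F M) (c : E) :
    LinearMap.det (1 - c • f.baseChange E) = Polynomial.aeval c f.charpoly.reverse := by
  let b := Module.finBasis F M
  rw [← LinearMap.charpoly_toMatrix f b, Matrix.reverse_charpoly,
    ← LinearMap.det_toMatrix (b.baseChange E), Matrix.charpolyRev, AlgHom.map_det]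
  congr 1
  ext i j
  by_cases h : i = j <;>
    simp [LinearMap.toMatrix_apply, h, Algebra.algebraMap_eq_smul_one, mul_comm c]

theorem reverse_charpoly_coeff_zero (f : Module.End F M) : f.charpoly.reverse.coeff 0 = 1 := by
  rw [Polynomial.coeff_zero_reverse, f.charpoly_monic.leadingCoeff]

/-- If `s` is the restriction of `f` along the injection `Γ`, and `f` is nilpotent modulo the image
of `Γ`, then `f` and `s` have the same reverse characteristic polynomial; here in the form of its
values in extensions of the ground field. -/
theorem det_one_sub_smul_baseChange_of_injective {Γ : N →ₗ[F] M} (hΓ : Function.Injective Γ)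
    {s : Module.End F N} {f : Module.End F M} (hs : Γ ∘ₗ s = f ∘ₗ Γ) {m : ℕ}
    (hf : ∀ x, (f ^ m) x ∈ LinearMap.range Γ) (c : E) :
    LinearMap.det (1 - c • f.baseChange E) = LinearMap.det (1 - c • s.baseChange E) := by
  obtain ⟨β, hβ⟩ := Γ.exists_leftInverse_of_injective (LinearMap.ker_eq_bot.mpr hΓ)
  have hfβ : f ^ m = Γ ∘ₗ (β ∘ₗ f ^ m) := by
    ext x
    obtain ⟨y, hy⟩ := hf x
    have := LinearMap.congr_fun hβ y
    simp only [LinearMap.comp_apply, LinearMap.id_apply] at this ⊢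
    rw [← hy, this]
  refine det_one_sub_of_injective (Γ := Γ.baseChange E) (m := m) ?_ ?_ ?_
  · exact Module.Flat.lTensor_preserves_injective_linearMap (M := E) Γ hΓ
  · rw [LinearMap.comp_smul, LinearMap.smul_comp, ← LinearMap.baseChange_comp, hs,
      LinearMap.baseChange_comp]
  · intro x
    rw [smul_pow, ← LinearMap.baseChange_pow, hfβ, LinearMap.baseChange_comp]
    exact Submodule.smul_mem _ _ ⟨_, rfl⟩

end BaseChange

/-! ### Characteristic polynomials in finite fields, and twisting by Lagrange interpolation -/

section FiniteFields

open Polynomial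

/-- In a finite separable extension `L/K`, the characteristic polynomial of `x` has as roots the
images of `x` under the embeddings of `L`. -/
theorem charpoly_lmul_eq_prod_embeddings {K L : Type*} (E : Type*) [Field K] [Field L] [Field E]
    [Algebra K L] [Algebra K E] [FiniteDimensional K L] [Algebra.IsSeparable K L] [IsAlgClosed E]
    (x : L) :
    (Algebra.lmul K L x).charpoly.map (algebraMap K E) = ∏ σ : L →ₐ[K] E, (X - C (σ x)) := by
  classical
  let b := Module.finBasis K L
  let e : Fin (Module.finrank K L) ≃ (L →ₐ[K] E) :=
    Fintype.equivOfCardEq (by rw [Fintype.card_fin, AlgHom.card])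
  let A := (Algebra.embeddingsMatrixReindex K E b e).transpose
  have hA : IsUnit A := by
    rw [Matrix.isUnit_iff_isUnit_det, isUnit_iff_ne_zero, Matrix.det_transpose]
    intro h
    apply Algebra.discr_not_zero_of_basis K b
    apply (algebraMap K E).injective
    rw [Algebra.discr_eq_det_embeddingsMatrixReindex_pow_two K E b e, h, map_zero,
      zero_pow two_ne_zero]
  obtain ⟨u, hu⟩ := hA
  have key : A * (LinearMap.toMatrix b b (Algebra.lmul K L x)).map (algebraMap K E) =
      Matrix.diagonal (fun i => e i x) * A := by
    ext i j
    rw [Matrix.diagonal_mul, Matrix.mul_apply]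
    have h := congrArg (e i) (b.sum_repr (x * b j))
    simp only [map_sum, map_mul, Algebra.smul_def, AlgHom.commutes] at h
    simp only [A, Matrix.transpose_apply, Algebra.embeddingsMatrixReindex, Matrix.reindex_apply,
      Matrix.submatrix_apply, Algebra.embeddingsMatrix_apply, Equiv.refl_symm, Equiv.refl_apply,
      Equiv.symm_symm, Matrix.map_apply, LinearMap.toMatrix_apply, Algebra.coe_lmul_eq_mul,
      LinearMap.mul_apply', ← h]
    exact Finset.sum_congr rfl fun _ _ => mul_comm _ _
  rw [← LinearMap.charpoly_toMatrix _ b, ← Matrix.charpoly_map, ← Matrix.charpoly_units_conj u, hu,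
    key, ← hu, mul_assoc, ← Matrix.coe_units_inv, Units.mul_inv, mul_one, Matrix.charpoly_diagonal]
  exact e.prod_comp (fun σ => X - C (σ x))

variable {k κ E : Type*} [Field k] [Fintype k] [Field κ] [Algebra k κ] [FiniteDimensional k κ]
  [Field E] [Algebra k E] [IsAlgClosed E]

theorem charpoly_lmul_eq_prod_range (j : κ →ₐ[k] E) (z : κ) :
    (Algebra.lmul k κ z).charpoly.map (algebraMap k E) =
      ∏ i ∈ Finset.range (Module.finrank k κ), (X - C (j z ^ Fintype.card k ^ i)) := by
  have : Finite κ := Module.finite_of_finite k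
  rw [charpoly_lmul_eq_prod_embeddings, Finset.prod_range]
  symm
  let g : Fin (Module.finrank k κ) → (κ →ₐ[k] E) :=
    fun i => j.comp (FiniteField.frobeniusAlgHom k κ ^ i.1)
  have hg : Function.Bijective g := by
    refine (Fintype.bijective_iff_injective_and_card g).mpr ⟨fun a b h => ?_, ?_⟩
    · apply (FiniteField.bijective_frobeniusAlgHom_pow k κ).1
      ext y
      exact j.injective (DFunLike.congr_fun h y)
    · rw [Fintype.card_fin, AlgHom.card]
  refine Fintype.prod_bijective g hg _ _ fun i => ?_
  simp only [g, AlgHom.comp_apply, AlgHom.coe_pow, FiniteField.coe_frobeniusAlgHom, pow_iterate,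
    map_pow]

/-- Let `z` lie in an extension of degree `d` of the field `k` with `q` elements, and let `P` be
its characteristic polynomial. If `c ^ d = P(x) ^ (-n)`, for a suitable choice of the root `c`,
then there is a polynomial `U`, invertible modulo the minimal polynomial of `z`, such that
`c U(X ^ q) (x - X) ^ n = U(X)` modulo this polynomial. -/
theorem exists_frobenius_twist (z : κ) (x : E) (n : ℕ)
    (hx : aeval x (Algebra.lmul k κ z).charpoly ≠ 0) :
    ∃ (c : E) (U U' : E[X]),
      c ^ Module.finrank k κ * aeval x (Algebra.lmul k κ z).charpoly ^ n = 1 ∧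
      (minpoly k z).map (algebraMap k E) ∣
        C c * U.comp (X ^ Fintype.card k) * (C x - X) ^ n - U ∧
      (minpoly k z).map (algebraMap k E) ∣ U * U' - 1 := by
  classical
  have : Finite κ := Module.finite_of_finite k
  have : Fintype κ := Fintype.ofFinite κ
  let j : κ →ₐ[k] E := IsAlgClosed.lift
  let q := Fintype.card k
  let d := Module.finrank k κ
  let s : ℕ → E := fun i => j z ^ q ^ i
  have hsucc (i : ℕ) : s i ^ q = s (i + 1) := by simp only [s, ← pow_mul, pow_succ]
  have hiter (i : ℕ) : (fun y : E => y ^ q)^[i] (j z) = s i := by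
    rw [pow_iterate]
  have hsd : Function.IsPeriodicPt (fun y : E => y ^ q) d (j z) := by
    change _ = _
    rw [hiter]
    change j z ^ q ^ d = j z
    rw [← map_pow, ← Module.card_eq_pow_finrank, FiniteField.pow_card]
  have hd : 0 < d := Module.finrank_pos
  let m := Function.minimalPeriod (fun y : E => y ^ q) (j z)
  have hm : 0 < m := hsd.minimalPeriod_pos hd
  obtain ⟨e, he⟩ : m ∣ d := hsd.minimalPeriod_dvd
  have hinj : Set.InjOn s (Finset.range m) := by
    intro a ha b hb hab
    rw [← hiter, ← hiter] at hab
    exact (Function.iterate_eq_iterate_iff_of_lt_minimalPeriod (Finset.mem_range.mp ha)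
      (Finset.mem_range.mp hb)).mp hab
  have hper (i : ℕ) : s (i + m) = s i := by
    rw [← hiter, ← hiter, Function.iterate_add_apply, Function.iterate_minimalPeriod]
  have hmul (e i : ℕ) : s (m * e + i) = s i := by
    induction e with
    | zero => simp
    | succ e ih => rw [mul_add, mul_one, add_right_comm, hper, ih]
  have hP : aeval x (Algebra.lmul k κ z).charpoly = ∏ i ∈ Finset.range d, (x - s i) := by
    rw [aeval_def, eval₂_eq_eval_map, charpoly_lmul_eq_prod_range j z, eval_prod]
    simp [s, d, q]
  let w : ℕ → E := fun i => (x - s i) ^ n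
  have hpow (e : ℕ) : ∏ i ∈ Finset.range (m * e), w i = (∏ i ∈ Finset.range m, w i) ^ e := by
    induction e with
    | zero => simp
    | succ e ih =>
      rw [mul_add, mul_one, Finset.prod_range_add, ih, pow_succ]
      simp only [w, hmul]
  have hPw : aeval x (Algebra.lmul k κ z).charpoly ^ n = (∏ i ∈ Finset.range m, w i) ^ e := by
    rw [hP, ← Finset.prod_pow, ← hpow, he]
  have hw0 : ∏ i ∈ Finset.range m, w i ≠ 0 := by
    intro h
    refine pow_ne_zero n hx ?_
    rw [hPw, h, zero_pow]
    rintro rfl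
    simp [he] at hd
  obtain ⟨c, hc⟩ := IsAlgClosed.exists_pow_nat_eq (∏ i ∈ Finset.range m, w i)⁻¹ hm
  have hc0 : c ≠ 0 := by
    rintro rfl
    rw [zero_pow hm.ne'] at hc
    exact inv_ne_zero hw0 hc.symm
  -- The values of `U` at the conjugates `s i` are the partial products `l i`.
  let l : ℕ → E := fun i => ∏ a ∈ Finset.range i, (c * w a)⁻¹
  have hlm : l m = 1 := by
    simp only [l, Finset.prod_inv_distrib, Finset.prod_mul_distrib, Finset.prod_const,
      Finset.card_range, hc]
    rw [inv_mul_cancel₀ hw0, inv_one]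
  have hlw (i : ℕ) (hi : i < m) : c * w i ≠ 0 :=
    mul_ne_zero hc0 (Finset.prod_ne_zero_iff.mp hw0 i (Finset.mem_range.mpr hi))
  have hl0 (i : ℕ) (hi : i < m) : l i ≠ 0 :=
    Finset.prod_ne_zero_iff.mpr fun a ha =>
      inv_ne_zero (hlw a ((Finset.mem_range.mp ha).trans hi))
  let U := Lagrange.interpolate (Finset.range m) s l
  let U' := Lagrange.interpolate (Finset.range m) s (fun i => (l i)⁻¹)
  have hU (i : ℕ) (hi : i < m) : U.eval (s i) = l i :=
    Lagrange.eval_interpolate_at_node _ hinj (Finset.mem_range.mpr hi)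
  have hU' (i : ℕ) (hi : i < m) : U'.eval (s i) = (l i)⁻¹ :=
    Lagrange.eval_interpolate_at_node _ hinj (Finset.mem_range.mpr hi)
  have hUm (i : ℕ) (hi : i ≤ m) : U.eval (s i) = l i := by
    rcases hi.lt_or_eq with h | rfl
    · exact hU i h
    · have h0 := hper 0
      rw [zero_add] at h0
      rw [h0, hU 0 hm, hlm]
      simp [l]
  have hdvd (H : E[X]) (hH : ∀ i < m, H.eval (s i) = 0) :
      (minpoly k z).map (algebraMap k E) ∣ H := by
    by_cases hH0 : H = 0
    · rw [hH0]; exact dvd_zero _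
    have hint : IsIntegral k z := Algebra.IsIntegral.isIntegral z
    have hmon : ((minpoly k z).map (algebraMap k E)).Monic := (minpoly.monic hint).map _
    have hsep : ((minpoly k z).map (algebraMap k E)).Separable :=
      Polynomial.Separable.map (Algebra.IsSeparable.isSeparable k z)
    refine (IsAlgClosed.splits _).dvd_of_roots_le_roots hmon.ne_zero ?_
    refine (Multiset.le_iff_subset (nodup_roots hsep)).mpr fun r hr => ?_
    rw [mem_roots hmon.ne_zero] at hr
    rw [mem_roots hH0]
    have h1 : minpoly k z ∣ (Algebra.lmul k κ z).charpoly :=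
      minpoly.dvd k z (Algebra.aeval_self_charpoly_lmul z)
    have h2 := hr.dvd (Polynomial.map_dvd (algebraMap k E) h1)
    rw [charpoly_lmul_eq_prod_range j z, IsRoot.def, eval_prod, Finset.prod_eq_zero_iff] at h2
    obtain ⟨i, -, hi⟩ := h2
    rw [eval_sub, eval_X, eval_C, sub_eq_zero] at hi
    have h3 : r = s (i % m) := by
      rw [hi, ← hmul (i / m) (i % m), Nat.div_add_mod]
    rw [IsRoot.def, h3]
    exact hH _ (Nat.mod_lt _ hm)
  refine ⟨c, U, U', ?_, hdvd _ fun i hi => ?_, hdvd _ fun i hi => ?_⟩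
  · change c ^ d * _ = 1
    rw [hPw, he, pow_mul, ← mul_pow, hc, inv_mul_cancel₀ hw0, one_pow]
  · simp only [eval_sub, eval_mul, eval_C, eval_comp, eval_pow, eval_X]
    change c * eval (s i ^ q) U * w i - _ = 0
    rw [hsucc, hUm _ hi, hU i hi]
    simp only [l, Finset.prod_range_succ]
    rw [sub_eq_zero, mul_right_comm, mul_comm, mul_assoc, inv_mul_cancel₀ (hlw i hi), mul_one]
  · rw [eval_sub, eval_mul, hU i hi, hU' i hi, eval_one, mul_inv_cancel₀ (hl0 i hi), sub_self]

/-- If `τ z = z ^ q τ` for operators `z` and `τ`, and `(x - z) ^ n a = 1`, then `a τ` is conjugate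
to the multiple `c τ` of `τ` by a scalar, with `c ^ d = P(x) ^ (-n)`. -/
theorem exists_det_one_sub_comp_eq {M : Type*} [AddCommGroup M] [Module E M]
    [FiniteDimensional E M] (z : κ) (x : E) (n : ℕ)
    (hx : aeval x (Algebra.lmul k κ z).charpoly ≠ 0) {Z τ a : Module.End E M}
    (hZ : aeval Z ((minpoly k z).map (algebraMap k E)) = 0)
    (hτ : τ * Z = Z ^ Fintype.card k * τ)
    (ha : (algebraMap E (Module.End E M) x - Z) ^ n * a = 1) :
    ∃ c : E, c ^ Module.finrank k κ * aeval x (Algebra.lmul k κ z).charpoly ^ n = 1 ∧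
      LinearMap.det (1 - a * τ) = LinearMap.det (1 - c • τ) := by
  obtain ⟨c, U, U', hc, h1, h2⟩ := exists_frobenius_twist z x n hx
  refine ⟨c, hc, ?_⟩
  have hcomm (H : E[X]) : τ * aeval Z H = aeval Z (H.comp (X ^ Fintype.card k)) * τ := by
    induction H using Polynomial.induction_on' with
    | add p q hp hq => rw [map_add, mul_add, hp, hq, add_comp, map_add, add_mul]
    | monomial i r =>
      have h : ∀ i, τ * Z ^ i = (Z ^ Fintype.card k) ^ i * τ := fun i => by
        induction i with
        | zero => simp
        | succ i ih => rw [pow_succ, ← mul_assoc, ih, mul_assoc, hτ, ← mul_assoc, ← pow_succ]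
      rw [aeval_monomial, monomial_comp, ← mul_assoc, ← Algebra.commutes, mul_assoc, h, map_mul,
        aeval_C, map_pow, map_pow, aeval_X, mul_assoc]
  have hker (H : E[X]) (hH : (minpoly k z).map (algebraMap k E) ∣ H) : aeval Z H = 0 := by
    obtain ⟨H', rfl⟩ := hH
    rw [map_mul, hZ, zero_mul]
  have e1 := hker _ h1
  have e2 := hker _ h2
  simp only [map_sub, map_mul, map_pow, aeval_C, aeval_X, map_one, sub_eq_zero] at e1 e2
  have e3 : aeval Z U * a = algebraMap E _ c * aeval Z (U.comp (X ^ Fintype.card k)) := by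
    rw [← e1, mul_assoc, ha, mul_one]
  have e4 : aeval Z U * (1 - a * τ) = (1 - c • τ) * aeval Z U := by
    rw [mul_sub, mul_one, sub_mul, one_mul, ← mul_assoc, e3, mul_assoc, ← hcomm, smul_mul_assoc,
      Algebra.smul_def]
  have e5 := congrArg LinearMap.det e4
  have e6 := congrArg LinearMap.det e2
  rw [map_mul, map_mul, mul_comm] at e5
  rw [map_mul, map_one] at e6
  exact mul_right_cancel₀ (left_ne_zero_of_mul_eq_one e6) e5

end FiniteFields

/-! ### Functoriality of the balanced tensor product -/

section BalancedMap

variable {k : Type*} [Field k] {F : Type*} [Field F] [Algebra k F] {G : Type*} [Group G]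
  {N : Type*} [AddCommGroup N] [Module F N] [Module k N] [IsScalarTower k F N]
  (r : Representation F Gᵐᵒᵖ N)
  {M M' M'' : Type*} [AddCommGroup M] [Module k M] [DistribMulAction G M]
  [AddCommGroup M'] [Module k M'] [DistribMulAction G M']
  [AddCommGroup M''] [Module k M''] [DistribMulAction G M'']

/-- The map `N ⊗_{k[G]} M → N ⊗_{k[G]} M'` induced by a `G`-equivariant `k`-linear map
`M → M'`. -/
def balancedMap (h : M →ₗ[k] M') (hh : ∀ (g : G) (m : M), h (g • m) = g • h m) :
    BalancedTensor k r M →ₗ[F] BalancedTensor k r M' :=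
  (balancedRel k r M).mapQ (balancedRel k r M')
    (TensorProduct.AlgebraTensorModule.map (LinearMap.id : N →ₗ[F] N) h)
    (by
      refine Submodule.span_le.mpr ?_
      rintro _ ⟨x, g, m, rfl⟩
      refine Submodule.subset_span ⟨x, g, h m, ?_⟩
      simp [hh])

variable {r}

theorem balancedMap_mk (h : M →ₗ[k] M') (hh : ∀ (g : G) (m : M), h (g • m) = g • h m)
    (x : N) (m : M) :
    balancedMap r h hh (Submodule.Quotient.mk (x ⊗ₜ[k] m)) =
      Submodule.Quotient.mk (x ⊗ₜ[k] h m) := rfl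

theorem BalancedTensor.hom_ext {P : Type*} [AddCommGroup P] [Module F P]
    {f f' : BalancedTensor k r M →ₗ[F] P}
    (h : ∀ (x : N) (m : M), f (Submodule.Quotient.mk (x ⊗ₜ[k] m)) =
      f' (Submodule.Quotient.mk (x ⊗ₜ[k] m))) : f = f' := by
  refine Submodule.linearMap_qext _ (LinearMap.ext fun y => ?_)
  induction y with
  | zero => simp only [map_zero]
  | tmul x m => exact h x m
  | add y y' hy hy' => rw [map_add, map_add, hy, hy']

theorem balancedTensorAction_X (θ : k[X] →ₐ[k] Module.End k M)
    (hθ : ∀ (g : G) (m : M), θ Polynomial.X (g • m) = g • θ Polynomial.X m) :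
    balancedTensorAction k r θ hθ Polynomial.X = balancedMap r (θ Polynomial.X) hθ :=
  Polynomial.aeval_X _

instance finite_balancedTensor [Module.Finite F N] [Module.Finite k M] :
    Module.Finite F (BalancedTensor k r M) := by
  have : Module.Finite F (F ⊗[k] M) := inferInstance
  have e : N ⊗[F] (F ⊗[k] M) ≃ₗ[F] N ⊗[k] M :=
    TensorProduct.AlgebraTensorModule.cancelBaseChange k F F N M
  have : Module.Finite F (N ⊗[k] M) := Module.Finite.equiv e
  infer_instance

end BalancedMap

section Coordinates

variable (k : Type*) [Field k] (n : ℕ) (M : Type*) [AddCommGroup M] [Module k M]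

/-- The inclusion of the `j`-th coordinate, counted from `1`; it is zero for `j = 0`. -/
def coordIncl (j : ℕ) : M →ₗ[k] (Fin n → M) where
  toFun b i := if i.1 + 1 = j then b else 0
  map_add' b b' := by
    funext i
    by_cases h : i.1 + 1 = j <;> simp [h]
  map_smul' c b := by
    funext i
    by_cases h : i.1 + 1 = j <;> simp [h]

/-- The projection to the first coordinate. -/
def coordProj [NeZero n] : (Fin n → M) →ₗ[k] M := LinearMap.proj 0

variable {k M}

theorem coordIncl_zero : coordIncl k n M 0 = 0 := by
  ext b i
  simp [coordIncl]

theorem coordProj_comp_coordIncl_one [NeZero n] :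
    coordProj k n M ∘ₗ coordIncl k n M 1 = LinearMap.id := by
  ext b
  simp [coordIncl, coordProj]

theorem coordProj_comp_coordIncl [NeZero n] {j : ℕ} (hj : j ≠ 0) :
    coordProj k n M ∘ₗ coordIncl k n M (j + 1) = 0 := by
  ext b
  simp [coordIncl, coordProj, hj.symm]

theorem coordIncl_smul {G : Type*} [Group G] [DistribMulAction G M] (j : ℕ) (g : G) (b : M) :
    coordIncl k n M j (g • b) = g • coordIncl k n M j b := by
  funext i
  by_cases h : i.1 + 1 = j <;> simp [coordIncl, h]

end Coordinates

/-! ### The local ratio as a determinant on one coordinate -/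

section CarlitzRatio

variable {k : Type*} [Field k] (n : ℕ) (B : Type*) [CommRing B] [Algebra k B]
variable {G : Type*} [Group G] [MulSemiringAction G B]

variable (k) in
/-- The `q`-power Frobenius, where `q` is the cardinality of `k`. -/
def frobT [Fintype k] : B →ₗ[k] B := (FiniteField.frobeniusAlgHom k B).toLinearMap

variable (k) in
/-- Multiplication by `z`, the image of `t`. -/
def mulT [Algebra k[X] B] : B →ₗ[k] B := LinearMap.mulLeft k (algebraMap k[X] B Polynomial.X)

variable {B}

theorem mulT_apply [Algebra k[X] B] (b : B) :
    mulT k B b = algebraMap k[X] B Polynomial.X * b := rfl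

theorem lieT_coordIncl [Algebra k[X] B] (j : ℕ) (hj : j < n) (b : B) :
    lieT k n B (coordIncl k n B (j + 1) b) =
      coordIncl k n B (j + 1) (mulT k B b) + coordIncl k n B j b := by
  funext i
  have hi := i.2
  simp only [lieT, coordIncl, mulT_apply, LinearMap.coe_mk, AddHom.coe_mk, Pi.add_apply]
  split_ifs <;> first | omega | simp

variable [Fintype k]

theorem frobT_apply (b : B) : frobT k B b = b ^ Fintype.card k := rfl

theorem frobT_smul (g : G) (b : B) : frobT k B (g • b) = g • frobT k B b := by
  simp [frobT_apply, smul_pow']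

variable [NeZero n] [Algebra k[X] B]

theorem carlitzT_eq (b : Fin n → B) :
    carlitzT k n B b = lieT k n B b + coordIncl k n B n (frobT k B (b 0)) := by
  funext i
  have hi := i.2
  simp only [carlitzT, lieT, coordIncl, frobT_apply, LinearMap.coe_mk, AddHom.coe_mk, Pi.add_apply]
  split_ifs <;> first | omega | simp

variable [IsScalarTower k k[X] B] [SMulCommClass G k[X] B]

theorem mulT_smul (g : G) (b : B) : mulT k B (g • b) = g • mulT k B b :=
  (smul_algebraMap_mul k B g Polynomial.X b).symm

variable {F : Type*} [Field F] [Algebra k F]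
  {N : Type*} [AddCommGroup N] [Module F N] [Module k N] [IsScalarTower k F N]
  [Module.Finite F N] [Module.Finite k B] (r : Representation F Gᵐᵒᵖ N)
  (E : Type*) [Field E] [Algebra F E]

/-- The ratio of the characteristic polynomials of `C^{⊗n}` and of its Lie algebra at `x` is
`det (1 - (x - z) ^ (-n) τ)`. -/
theorem aeval_charPoly_carlitz (x : E) {a : Module.End E (E ⊗[F] BalancedTensor k r B)}
    (ha : (algebraMap E (Module.End E (E ⊗[F] BalancedTensor k r B)) x -
      (balancedMap r (mulT k B) mulT_smul).baseChange E) * a = 1) :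
    Polynomial.aeval x (charPoly (balancedTensorAction k r (carlitz k n B) (carlitz_smul k n B))) =
      Polynomial.aeval x (charPoly (balancedTensorAction k r (lie k n B) (lie_smul k n B))) *
        LinearMap.det (1 - a ^ n * (balancedMap r (frobT k B) frobT_smul).baseChange E) := by
  have hlie : lie k n B Polynomial.X = lieT k n B := Polynomial.aeval_X _
  have hcar : carlitz k n B Polynomial.X = carlitzT k n B := Polynomial.aeval_X _
  let κ (j : ℕ) : BalancedTensor k r B →ₗ[F] BalancedTensor k r (Fin n → B) :=
    balancedMap r (coordIncl k n B j) (coordIncl_smul n j)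
  let π : BalancedTensor k r (Fin n → B) →ₗ[F] BalancedTensor k r B :=
    balancedMap r (coordProj k n B) fun _ _ => rfl
  have hn : 0 < n := Nat.pos_of_ne_zero (NeZero.ne n)
  have h1 : balancedMap r (carlitz k n B Polynomial.X) (carlitz_smul k n B) =
      balancedMap r (lie k n B Polynomial.X) (lie_smul k n B) +
        κ n ∘ₗ balancedMap r (frobT k B) frobT_smul ∘ₗ π := by
    refine BalancedTensor.hom_ext fun v m => ?_
    change (Submodule.Quotient.mk (v ⊗ₜ[k] carlitz k n B Polynomial.X m) :
      BalancedTensor k r (Fin n → B)) = Submodule.Quotient.mk (v ⊗ₜ[k] lie k n B Polynomial.X m) +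
        Submodule.Quotient.mk (v ⊗ₜ[k] coordIncl k n B n (frobT k B (m 0)))
    rw [hlie, hcar, carlitzT_eq n m, TensorProduct.tmul_add, Submodule.Quotient.mk_add]
  rw [charPoly_eq_charpoly, charPoly_eq_charpoly, balancedTensorAction_X, balancedTensorAction_X,
    ← det_smul_sub_baseChange, ← det_smul_sub_baseChange, h1, LinearMap.baseChange_add,
    LinearMap.baseChange_comp, LinearMap.baseChange_comp]
  refine (congrArg LinearMap.det (sub_sub
    (_ : Module.End E (E ⊗[F] BalancedTensor k r (Fin n → B))) _ _).symm).trans ?_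
  refine det_companion (κ := fun j => (κ j).baseChange E) hn ?_ ?_ ha ?_ ?_ _
  · have : κ 0 = 0 := by
      refine BalancedTensor.hom_ext fun v m => ?_
      simp only [κ, balancedMap_mk, coordIncl_zero, LinearMap.zero_apply, TensorProduct.tmul_zero]
      rfl
    simp only [this, LinearMap.baseChange_zero]
  · intro j hj
    have h : balancedMap r (lie k n B Polynomial.X) (lie_smul k n B) ∘ₗ κ (j + 1) =
        κ (j + 1) ∘ₗ balancedMap r (mulT k B) mulT_smul + κ j := by
      refine BalancedTensor.hom_ext fun v m => ?_
      simp only [LinearMap.add_apply, LinearMap.comp_apply, κ, balancedMap_mk, hlie,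
        lieT_coordIncl n j hj m, TensorProduct.tmul_add, Submodule.Quotient.mk_add]
    rw [LinearMap.sub_comp, LinearMap.comp_sub, ← LinearMap.baseChange_comp, h,
      LinearMap.baseChange_add, LinearMap.baseChange_comp]
    refine (sub_sub (_ : E ⊗[F] BalancedTensor k r B →ₗ[E]
      E ⊗[F] BalancedTensor k r (Fin n → B)) _ _).symm.trans ?_
    congr 2
    ext m
    simp
  · have : π ∘ₗ κ 1 = LinearMap.id := by
      refine BalancedTensor.hom_ext fun v m => ?_
      change Submodule.Quotient.mk (v ⊗ₜ[k] coordIncl k n B 1 m 0) = _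
      simp [coordIncl]
    rw [← LinearMap.baseChange_comp, this, LinearMap.baseChange_id]
    rfl
  · intro j hj hj0
    have : π ∘ₗ κ (j + 1) = 0 := by
      refine BalancedTensor.hom_ext fun v m => ?_
      change Submodule.Quotient.mk (v ⊗ₜ[k] coordIncl k n B (j + 1) m 0) = _
      simp [coordIncl, hj0.symm]
    rw [← LinearMap.baseChange_comp, this, LinearMap.baseChange_zero]

end CarlitzRatio

/-! ### Removing the multiplication operator from the local ratio -/

section Twist

variable {k : Type*} [Field k] [Fintype k] (n : ℕ) [NeZero n]
variable {B : Type*} [CommRing B] [Algebra k B] [Algebra k[X] B] [IsScalarTower k k[X] B]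
variable {G : Type*} [Group G] [MulSemiringAction G B] [SMulCommClass G k[X] B]
variable {F : Type*} [Field F] [Algebra k F]
  {N : Type*} [AddCommGroup N] [Module F N] [Module k N] [IsScalarTower k F N]
  (r : Representation F Gᵐᵒᵖ N) {κ : Type*} [Field κ] [Algebra k κ] [Algebra κ B]
  [IsScalarTower k κ B]

theorem aeval_balancedMap_mulT {z : κ}
    (hz : algebraMap κ B z = algebraMap k[X] B Polynomial.X) (p : k[X]) (v : N) (b : B) :
    Polynomial.aeval (balancedMap r (mulT k B) mulT_smul) (p.map (algebraMap k F))
      (Submodule.Quotient.mk (v ⊗ₜ[k] b)) =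
        Submodule.Quotient.mk (v ⊗ₜ[k] (algebraMap κ B (Polynomial.aeval z p) * b)) := by
  induction p using Polynomial.induction_on' with
  | add p p' hp hp' =>
    rw [Polynomial.map_add, map_add, LinearMap.add_apply, hp, hp', map_add, map_add, add_mul,
      TensorProduct.tmul_add, Submodule.Quotient.mk_add]
  | monomial i c =>
    have h : ∀ i, (balancedMap r (mulT k B) mulT_smul ^ i) (Submodule.Quotient.mk (v ⊗ₜ[k] b)) =
        Submodule.Quotient.mk (v ⊗ₜ[k] (algebraMap κ B z ^ i * b)) := fun i => by
      induction i with
      | zero => simp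
      | succ i ih =>
        rw [pow_succ', Module.End.mul_apply, ih, balancedMap_mk, mulT_apply, ← hz, pow_succ',
          mul_assoc]
    rw [Polynomial.map_monomial, Polynomial.aeval_monomial, Polynomial.aeval_monomial,
      Module.End.mul_apply, h, Module.algebraMap_end_apply, ← Submodule.Quotient.mk_smul, map_mul,
      map_pow, ← IsScalarTower.algebraMap_apply, mul_assoc, ← Algebra.smul_def,
      TensorProduct.tmul_smul, algebraMap_smul]

variable [Module.Finite F N] [Module.Finite k B] [FiniteDimensional k κ]
variable {E : Type*} [Field E] [Algebra F E] [Algebra k E] [IsScalarTower k F E] [IsAlgClosed E]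

/-- The ratio of the characteristic polynomials of `C^{⊗n}` and of its Lie algebra, for an algebra
`B` over a finite extension `κ` of `k`, of degree `d`: at `x` it is `det (1 - c τ)`, for some `c`
with `c ^ d = |κ|(x) ^ (-n)`. -/
theorem exists_aeval_charPoly_carlitz {z : κ}
    (hz : algebraMap κ B z = algebraMap k[X] B Polynomial.X) {x : E}
    (hx : ∀ P : F[X], P.Monic → Polynomial.aeval x P ≠ 0) :
    ∃ c : E, c ^ Module.finrank k κ *
        Polynomial.aeval x (Algebra.lmul k κ z).charpoly ^ n = 1 ∧
      Polynomial.aeval x (charPoly (balancedTensorAction k r (carlitz k n B) (carlitz_smul k n B))) =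
      Polynomial.aeval x (charPoly (balancedTensorAction k r (lie k n B) (lie_smul k n B))) *
        LinearMap.det (1 - c • (balancedMap r (frobT k B) frobT_smul).baseChange E) := by
  let Zf : Module.End F (BalancedTensor k r B) := balancedMap r (mulT k B) mulT_smul
  let Z : Module.End E (E ⊗[F] BalancedTensor k r B) := Zf.baseChange E
  let τf : Module.End F (BalancedTensor k r B) := balancedMap r (frobT k B) frobT_smul
  have hunit : IsUnit (algebraMap E (Module.End E (E ⊗[F] BalancedTensor k r B)) x - Z) := by
    rw [LinearMap.isUnit_iff_isUnit_det, isUnit_iff_ne_zero, Algebra.algebraMap_eq_smul_one]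
    exact (det_smul_sub_baseChange E Zf x).trans_ne (hx _ Zf.charpoly_monic)
  obtain ⟨u, hu⟩ := hunit
  let a : Module.End E (E ⊗[F] BalancedTensor k r B) := ((u⁻¹ : (Module.End E _)ˣ) : Module.End E _)
  have ha : (algebraMap E (Module.End E (E ⊗[F] BalancedTensor k r B)) x - Z) * a = 1 := by
    rw [← hu]
    exact u.mul_inv
  have ha' : (algebraMap E (Module.End E (E ⊗[F] BalancedTensor k r B)) x - Z) ^ n * a ^ n = 1 := by
    rw [← hu]
    have h : (u ^ n * u⁻¹ ^ n : (Module.End E _)ˣ) = 1 := by rw [inv_pow, mul_inv_cancel]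
    exact congrArg Units.val h
  have hZf : Polynomial.aeval Zf ((minpoly k z).map (algebraMap k F)) = 0 := by
    refine BalancedTensor.hom_ext fun v b => ?_
    refine (aeval_balancedMap_mulT r hz (minpoly k z) v b).trans ?_
    rw [minpoly.aeval, map_zero, zero_mul, TensorProduct.tmul_zero]
    rfl
  have hZ : Polynomial.aeval Z ((minpoly k z).map (algebraMap k E)) = 0 := by
    rw [IsScalarTower.algebraMap_eq k F E, ← Polynomial.map_map, Polynomial.aeval_map_algebraMap]
    exact (Polynomial.aeval_algHom_apply (Module.End.baseChangeHom F E (BalancedTensor k r B)) Zf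
      ((minpoly k z).map (algebraMap k F))).trans ((congrArg _ hZf).trans (map_zero _))
  have hτf : τf * Zf = Zf ^ Fintype.card k * τf := by
    refine BalancedTensor.hom_ext fun v b => ?_
    have h := aeval_balancedMap_mulT r hz (Polynomial.X ^ Fintype.card k) v (frobT k B b)
    rw [Polynomial.map_pow, Polynomial.map_X, map_pow, Polynomial.aeval_X, map_pow,
      Polynomial.aeval_X, map_pow, hz] at h
    refine Eq.trans ?_ h.symm
    change (Submodule.Quotient.mk (v ⊗ₜ[k] frobT k B (mulT k B b)) : BalancedTensor k r B) = _
    rw [mulT_apply, frobT_apply, frobT_apply, mul_pow]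
  have hτ : τf.baseChange E * Z = Z ^ Fintype.card k * τf.baseChange E := by
    have h := congrArg (Module.End.baseChangeHom F E (BalancedTensor k r B)) hτf
    rw [map_mul, map_mul, map_pow] at h
    exact h
  have hx' : Polynomial.aeval x (Algebra.lmul k κ z).charpoly ≠ 0 := by
    rw [← Polynomial.aeval_map_algebraMap F]
    exact hx _ ((LinearMap.charpoly_monic _).map _)
  obtain ⟨c, hc, hdet⟩ := exists_det_one_sub_comp_eq z x n hx' hZ hτ ha'
  exact ⟨c, hc, (aeval_charPoly_carlitz n r E x ha).trans (congrArg _ hdet)⟩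

end Twist

/-! ### The dual of `V* ⊗_{k[G]} M` -/

section Lift

variable {k : Type*} [Field k] {F : Type*} [Field F] [Algebra k F] {G : Type*} [Group G]
  {N : Type*} [AddCommGroup N] [Module F N] [Module k N] [IsScalarTower k F N]
  {r : Representation F Gᵐᵒᵖ N}
  {M : Type*} [AddCommGroup M] [Module k M] [DistribMulAction G M]
  {P : Type*} [AddCommGroup P] [Module F P]

/-- An `F`-linear map on `N ⊗_k M` which satisfies the relations `x g ⊗ m = x ⊗ g m` descends to
`N ⊗_{k[G]} M`. -/
def balancedLift (f : N ⊗[k] M →ₗ[F] P) (hf : ∀ (x : N) (g : G) (m : M),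
    f (r (MulOpposite.op g) x ⊗ₜ[k] m) = f (x ⊗ₜ[k] (g • m))) : BalancedTensor k r M →ₗ[F] P :=
  Submodule.liftQ (balancedRel k r M) f (by
    refine Submodule.span_le.mpr ?_
    rintro _ ⟨x, g, m, rfl⟩
    rw [SetLike.mem_coe, LinearMap.mem_ker, map_sub, hf, sub_self])

end Lift

section Duality

variable {k : Type*} [Field k] {F : Type*} [Field F] [Algebra k F] {G : Type*} [Group G]
  {V : Type*} [AddCommGroup V] [Module F V] [Module k V] [IsScalarTower k F V]
  (ρ : Representation F G V)
  (M : Type*) [AddCommGroup M] [Module k M] [DistribMulAction G M]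

variable (k) in
/-- The `F`-vector space `Hom_{k[G]}(M, V)`. -/
def equivariantHom : Submodule F (M →ₗ[k] V) where
  carrier := {f | ∀ (g : G) (m : M), f (g • m) = ρ g (f m)}
  zero_mem' g m := by simp
  add_mem' hf hf' g m := by simp [hf g m, hf' g m]
  smul_mem' c f hf g m := by simp [hf g m]

variable {ρ M}

/-- The pairing of `Hom_k(M, V)` with `V* ⊗_k M`. -/
def tensorPairing (f : M →ₗ[k] V) : Module.Dual F V ⊗[k] M →ₗ[F] F :=
  TensorProduct.AlgebraTensorModule.lift
    { toFun := fun φ =>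
        { toFun := fun m => φ (f m)
          map_add' := fun m m' => by rw [map_add, map_add]
          map_smul' := fun c m => by
            rw [map_smul, RingHom.id_apply, ← algebraMap_smul F c (f m), map_smul, algebraMap_smul] }
      map_add' := fun _ _ => rfl
      map_smul' := fun _ _ => rfl }

/-- The functional on `V* ⊗_{k[G]} M` given by an element of `Hom_{k[G]}(M, V)`. -/
def dualPairingFun (f : equivariantHom k ρ M) : BalancedTensor k (dualRight ρ) M →ₗ[F] F :=
  balancedLift (tensorPairing f.1) fun φ g m => congrArg φ (f.2 g m).symm

variable (ρ M) in
/-- The pairing of `Hom_{k[G]}(M, V)` with `V* ⊗_{k[G]} M`. -/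
def dualPairing : equivariantHom k ρ M →ₗ[F]
    Module.Dual F (BalancedTensor k (dualRight ρ) M) where
  toFun f := dualPairingFun f
  map_add' f f' := by
    refine BalancedTensor.hom_ext fun φ m => ?_
    exact φ.map_add (f.1 m) (f'.1 m)
  map_smul' c f := by
    refine BalancedTensor.hom_ext fun φ m => ?_
    exact φ.map_smul c (f.1 m)

theorem dualPairing_apply (f : equivariantHom k ρ M) (φ : Module.Dual F V) (m : M) :
    dualPairing ρ M f (Submodule.Quotient.mk (φ ⊗ₜ[k] m)) = φ (f.1 m) := rfl

theorem dualPairing_injective : Function.Injective (dualPairing (k := k) ρ M) := by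
  refine (injective_iff_map_eq_zero _).mpr fun f hf => ?_
  apply Subtype.ext
  ext m
  refine (Module.forall_dual_apply_eq_zero_iff F _).mp fun φ => ?_
  rw [← dualPairing_apply, hf]
  rfl

theorem dualPairing_surjective [FiniteDimensional F V] :
    Function.Surjective (dualPairing (k := k) ρ M) := by
  intro ξ
  let η (m : M) : Module.Dual F (Module.Dual F V) :=
    { toFun := fun φ => ξ (Submodule.Quotient.mk (φ ⊗ₜ[k] m))
      map_add' := fun φ φ' => by
        rw [TensorProduct.add_tmul, Submodule.Quotient.mk_add, map_add]
      map_smul' := fun c φ => by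
        rw [← TensorProduct.smul_tmul', Submodule.Quotient.mk_smul, map_smul]
        rfl }
  let v (m : M) : V := (Module.evalEquiv F V).symm (η m)
  have hv (m : M) (φ : Module.Dual F V) : φ (v m) = ξ (Submodule.Quotient.mk (φ ⊗ₜ[k] m)) := by
    have : Module.evalEquiv F V (v m) = η m := LinearEquiv.apply_symm_apply _ _
    exact LinearMap.congr_fun this φ
  have hsep {x y : V} (h : ∀ φ : Module.Dual F V, φ x = φ y) : x = y :=
    sub_eq_zero.mp ((Module.forall_dual_apply_eq_zero_iff F _).mp fun φ => by
      rw [map_sub, h, sub_self])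
  let f : M →ₗ[k] V :=
    { toFun := v
      map_add' := fun m m' => hsep fun φ => by
        rw [map_add, hv, hv, hv, TensorProduct.tmul_add, Submodule.Quotient.mk_add, map_add]
      map_smul' := fun c m => hsep fun φ => by
        have h : φ ⊗ₜ[k] (c • m) = algebraMap k F c • (φ ⊗ₜ[k] m) := by
          rw [TensorProduct.smul_tmul', algebraMap_smul, TensorProduct.smul_tmul]
        rw [RingHom.id_apply, ← algebraMap_smul F c (v m), map_smul, hv, hv, h,
          Submodule.Quotient.mk_smul, map_smul] }
  have hf : f ∈ equivariantHom k ρ M := fun g m => hsep fun φ => by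
    change φ (v (g • m)) = dualRight ρ (MulOpposite.op g) φ (v m)
    rw [hv, hv]
    refine congrArg ξ ?_
    symm
    rw [Submodule.Quotient.eq]
    exact Submodule.subset_span ⟨φ, g, m, rfl⟩
  exact ⟨⟨f, hf⟩, BalancedTensor.hom_ext fun φ m => hv m φ⟩

end Duality

/-! ### Equivariant maps out of a ring with an action of a decomposition group -/

/-- The action of `G` on a finite `k`-algebra `R` (which will be `𝒪_L / p 𝒪_L`), seen from one of
its residue fields `π : R → ℓ`: the group `I` is the inertia group of `π`, and the decomposition
group acts on `ℓ` through powers of a Frobenius element, which induces the `q ^ d`-power map.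
The field `exists_pow_eq_zero` expresses that `G` permutes the residue fields of `R` transitively: an
element which vanishes at all conjugates of `π` is nilpotent. -/
structure ResidueData (k R ℓ : Type*) {G : Type*} [Field k] [Fintype k] [CommRing R] [Algebra k R]
    [Field ℓ] [Algebra k ℓ] [Group G] [MulSemiringAction G R] (I : Subgroup G) (d : ℕ) where
  π : R →ₐ[k] ℓ
  surjective : Function.Surjective π
  frob : G
  π_frob : ∀ x, π (frob • x) = π x ^ Fintype.card k ^ d
  exists_pow : ∀ g : G, (∀ x, π x = 0 → π (g • x) = 0) →
    ∃ a : ℕ, ∀ x, π (g • x) = π x ^ Fintype.card k ^ (d * a)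
  mem_inertia : ∀ g, g ∈ I ↔ ∀ x, π (g • x) = π x
  exists_pow_eq_zero : ∃ N : ℕ, ∀ x, (∀ g : G, π (g • x) = 0) → x ^ Fintype.card k ^ N = 0
  dvd : d ∣ Module.finrank k ℓ

theorem exists_normalBasis_pow (k ℓ : Type*) [Field k] [Fintype k] [Field ℓ] [Algebra k ℓ]
    [FiniteDimensional k ℓ] : ∃ (y : ℓ) (b : Module.Basis (Fin (Module.finrank k ℓ)) k ℓ),
      ∀ i, b i = y ^ Fintype.card k ^ i.1 := by
  have : Finite ℓ := Module.finite_of_finite k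
  let e := Equiv.ofBijective _ (FiniteField.bijective_frobeniusAlgEquivOfAlgebraic_pow k ℓ)
  refine ⟨IsGalois.normalBasis k ℓ 1, (IsGalois.normalBasis k ℓ).reindex e.symm, fun i => ?_⟩
  rw [Module.Basis.reindex_apply, Equiv.symm_symm, IsGalois.normalBasis_apply]
  simp only [e, Equiv.ofBijective_apply, AlgEquiv.coe_pow,
    FiniteField.coe_frobeniusAlgEquivOfAlgebraic_iterate]

/-- The operator `(h₀, …, h_{d-1}) ↦ (h₁, …, h_{d-1}, φ h₀)`. -/
def cyclicShift {F U : Type*} [Field F] [AddCommGroup U] [Module F U] (d : ℕ) [NeZero d]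
    (φ : Module.End F U) : Module.End F (Fin d → U) where
  toFun h i := if hi : i.1 + 1 < d then h ⟨i.1 + 1, hi⟩ else φ (h 0)
  map_add' h h' := by
    funext i
    by_cases hi : i.1 + 1 < d <;> simp [hi]
  map_smul' c h := by
    funext i
    by_cases hi : i.1 + 1 < d <;> simp [hi]

namespace ResidueData

variable {k R ℓ G : Type*} [Field k] [Fintype k] [CommRing R] [Algebra k R]
  [Field ℓ] [Algebra k ℓ] [Group G] [MulSemiringAction G R] {I : Subgroup G} {d : ℕ}
  (D : ResidueData k R ℓ I d)

theorem π_frob_pow (a : ℕ) (x : R) : D.π ((D.frob ^ a) • x) = D.π x ^ Fintype.card k ^ (d * a) := by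
  induction a with
  | zero => simp
  | succ a ih => rw [pow_succ', mul_smul, D.π_frob, ih, ← pow_mul, ← pow_add, mul_add, mul_one]

/-- The elements of `R` all of whose conjugates vanish at `π`. -/
def rad : Ideal R where
  carrier := {x | ∀ g : G, D.π (g • x) = 0}
  zero_mem' g := by simp
  add_mem' hx hy g := by rw [smul_add, map_add, hx, hy, add_zero]
  smul_mem' c x hx g := by rw [smul_eq_mul, smul_mul', map_mul, hx, mul_zero]

section Supp

variable [Finite G]

/-- The decomposition group of `π`. -/
def decomp : Subgroup G where
  carrier := {g | ∀ x, D.π x = 0 → D.π (g • x) = 0}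
  one_mem' x hx := by rwa [one_smul]
  mul_mem' {g h} hg hh x hx := by
    rw [mul_smul]
    exact hg _ (hh _ hx)
  inv_mem' {g} hg := by
    obtain ⟨j, hj⟩ : g⁻¹ ∈ Submonoid.powers g :=
      (isOfFinOrder_of_finite g).mem_powers_iff_mem_zpowers.mpr
        (inv_mem (Subgroup.mem_zpowers g))
    have hpow : ∀ j x, D.π x = 0 → D.π (g ^ j • x) = 0 := fun j => by
      induction j with
      | zero => simp
      | succ j ih =>
        intro x hx
        rw [pow_succ, mul_smul]
        exact ih _ (hg x hx)
    intro x hx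
    rw [← hj]
    exact hpow j x hx

theorem mem_decomp {g : G} : g ∈ D.decomp ↔ ∀ x, D.π x = 0 → D.π (g • x) = 0 := Iff.rfl

/-- The elements of `R` whose conjugates by elements outside the decomposition group vanish at `π`,
that is, the elements which vanish at the residue fields other than `π`. -/
def supp : Ideal R where
  carrier := {x | ∀ g ∉ D.decomp, D.π (g • x) = 0}
  zero_mem' g _ := by simp
  add_mem' hx hy g hg := by rw [smul_add, map_add, hx g hg, hy g hg, add_zero]
  smul_mem' c x hx g hg := by rw [smul_eq_mul, smul_mul', map_mul, hx g hg, mul_zero]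

theorem mem_rad_of_mem_supp {x : R} (hx : x ∈ D.supp) (h : D.π x = 0) : x ∈ D.rad := fun g => by
  by_cases hg : g ∈ D.decomp
  · exact hg x h
  · exact hx g hg

theorem smul_mem_supp {g : G} (hg : g ∈ D.decomp) {x : R} (hx : x ∈ D.supp) : g • x ∈ D.supp :=
  fun h hh => by
    rw [← mul_smul]
    exact hx _ fun h' => hh ((D.decomp.mul_mem_cancel_right hg).mp h')

theorem frob_mem_decomp : D.frob ∈ D.decomp := fun x hx => by
  rw [D.π_frob, hx, zero_pow (pow_ne_zero _ Fintype.card_ne_zero)]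

theorem inertia_le_decomp : I ≤ D.decomp := fun g hg x hx => by
  rw [(D.mem_inertia g).mp hg, hx]

theorem exists_mem_supp (y : ℓ) : ∃ x ∈ D.supp, D.π x = y := by
  classical
  have := Fintype.ofFinite G
  have h : ∀ g : G, ∃ e : R, D.π e ≠ 0 ∧ (g ∉ D.decomp → D.π (g • e) = 0) := fun g => by
    by_cases hg : g ∈ D.decomp
    · exact ⟨1, by simp, fun h => absurd hg h⟩
    · have hg' : g⁻¹ ∉ D.decomp := fun h => hg (inv_mem_iff.mp h)
      rw [D.mem_decomp] at hg'
      push Not at hg'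
      obtain ⟨x, hx, hx'⟩ := hg'
      exact ⟨g⁻¹ • x, hx', fun _ => by rwa [smul_inv_smul]⟩
  choose e he he' using h
  have h0 : D.π (∏ g, e g) ≠ 0 := by
    rw [map_prod]
    exact Finset.prod_ne_zero_iff.mpr fun g _ => he g
  obtain ⟨z, hz⟩ := D.surjective ((D.π (∏ g, e g))⁻¹ * y)
  refine ⟨(∏ g, e g) * z, fun g hg => ?_, ?_⟩
  · rw [smul_mul', map_mul, Finset.smul_prod', map_prod,
      Finset.prod_eq_zero (Finset.mem_univ g) (he' g hg), zero_mul]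
  · rw [map_mul, hz, mul_inv_cancel_left₀ h0]

/-- Every element of `R` is a sum of conjugates of elements of `D.supp`, modulo `D.rad`. -/
theorem sub_sum_mem_rad [Fintype (G ⧸ D.decomp)] {e : R} (he : e ∈ D.supp) (he1 : D.π e = 1)
    (x : R) : x - ∑ c : G ⧸ D.decomp, c.out • (e * c.out⁻¹ • x) ∈ D.rad := fun h => by
  classical
  have hsum : ∑ c : G ⧸ D.decomp, D.π (h • c.out • e) = 1 := by
    rw [Finset.sum_eq_single (QuotientGroup.mk h⁻¹)]
    · rw [← mul_smul]
      have hm : h * (QuotientGroup.mk h⁻¹ : G ⧸ D.decomp).out ∈ D.decomp := by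
        have := QuotientGroup.eq.mp (QuotientGroup.out_eq' (QuotientGroup.mk h⁻¹ : G ⧸ D.decomp)).symm
        rwa [inv_inv] at this
      obtain ⟨a, ha⟩ := D.exists_pow _ hm
      rw [ha, he1, one_pow]
    · intro c _ hc
      rw [← mul_smul]
      refine he _ fun hm => hc ?_
      rw [← QuotientGroup.out_eq' c]
      refine (QuotientGroup.eq.mpr ?_).symm
      rwa [inv_inv]
    · exact fun hn => absurd (Finset.mem_univ _) hn
  rw [smul_sub, map_sub, Finset.smul_sum, map_sum]
  simp only [smul_mul', smul_inv_smul, map_mul]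
  rw [← Finset.sum_mul, hsum, one_mul, sub_self]

end Supp

section Hom

variable {F V : Type*} [Field F] [Algebra k F] [AddCommGroup V] [Module F V] [Module k V]
  [IsScalarTower k F V] {ρ : Representation F G V} {U : Submodule F V}

theorem map_eq_of_sub_mem_rad {f : R →ₗ[k] V} (hrad : ∀ x ∈ D.rad, f x = 0) {x y : R}
    (h : x - y ∈ D.rad) : f x = f y :=
  sub_eq_zero.mp ((map_sub f x y).symm.trans (hrad _ h))

variable [Finite G]

theorem map_frob_smul {f : R →ₗ[k] V} (hrad : ∀ x ∈ D.rad, f x = 0) {x : R} (hx : x ∈ D.supp) :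
    f (x ^ Fintype.card k ^ d) = f (D.frob • x) := by
  refine D.map_eq_of_sub_mem_rad hrad (D.mem_rad_of_mem_supp
    (sub_mem (Ideal.pow_mem_of_mem _ hx _ (pow_pos Fintype.card_pos _))
      (D.smul_mem_supp D.frob_mem_decomp hx)) ?_)
  rw [map_sub, D.π_frob, map_pow, sub_self]

theorem map_mem_invariants (hU : ∀ v, v ∈ U ↔ ∀ g ∈ I, ρ g v = v) {f : R →ₗ[k] V}
    (hf : f ∈ equivariantHom k ρ R) (hrad : ∀ x ∈ D.rad, f x = 0) {x : R} (hx : x ∈ D.supp) :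
    f x ∈ U := by
  refine (hU _).mpr fun g hg => ?_
  rw [← hf]
  refine D.map_eq_of_sub_mem_rad hrad (D.mem_rad_of_mem_supp
    (sub_mem (D.smul_mem_supp (D.inertia_le_decomp hg) hx) hx) ?_)
  rw [map_sub, (D.mem_inertia g).mp hg, sub_self]

/-- A `G`-equivariant map which vanishes on `D.rad` is determined by its values on the powers of a
lift of a normal basis generator. -/
theorem eq_zero_of_map_pow_eq_zero [NeZero d] {y : ℓ}
    (b : Module.Basis (Fin (Module.finrank k ℓ)) k ℓ)
    (hb : ∀ i, b i = y ^ Fintype.card k ^ i.1) {f : R →ₗ[k] V}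
    (hf : f ∈ equivariantHom k ρ R) (hrad : ∀ x ∈ D.rad, f x = 0) {x : R} (hx : x ∈ D.supp)
    (hxy : D.π x = y) (h : ∀ i < d, f (x ^ Fintype.card k ^ i) = 0) : f = 0 := by
  have := Fintype.ofFinite (G ⧸ D.decomp)
  have hpow (i : ℕ) : x ^ Fintype.card k ^ i ∈ D.supp :=
    Ideal.pow_mem_of_mem _ hx _ (pow_pos Fintype.card_pos _)
  have hall : ∀ i, f (x ^ Fintype.card k ^ i) = 0 := fun i => by
    induction i using Nat.strong_induction_on with
    | _ i ih =>
      by_cases hi : i < d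
      · exact h i hi
      · obtain ⟨j, rfl⟩ := Nat.exists_eq_add_of_le' (not_lt.mp hi)
        rw [pow_add, pow_mul, D.map_frob_smul hrad (hpow j), hf,
          ih j (Nat.lt_add_of_pos_right (Nat.pos_of_ne_zero (NeZero.ne d))), map_zero]
  have hsupp {w : R} (hw : w ∈ D.supp) : f w = 0 := by
    have hmem : w - ∑ i, b.repr (D.π w) i • x ^ Fintype.card k ^ i.1 ∈ D.rad := by
      refine D.mem_rad_of_mem_supp (sub_mem hw (sum_mem fun i _ =>
        Submodule.smul_of_tower_mem _ _ (hpow i))) ?_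
      simp only [map_sub, map_sum, map_smul, map_pow, hxy, ← hb, b.sum_repr, sub_self]
    rw [D.map_eq_of_sub_mem_rad hrad hmem, map_sum]
    exact Finset.sum_eq_zero fun i _ => by rw [map_smul, hall, smul_zero]
  obtain ⟨e, he, he1⟩ := D.exists_mem_supp 1
  ext w
  rw [D.map_eq_of_sub_mem_rad hrad (D.sub_sum_mem_rad he he1 w), map_sum]
  exact Finset.sum_eq_zero fun c _ => by rw [hf, hsupp (Ideal.mul_mem_right _ _ he), map_zero]

end Hom

end ResidueData

namespace ResidueData

variable {k R ℓ G : Type*} [Field k] [Fintype k] [CommRing R] [Algebra k R]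
  [Field ℓ] [Algebra k ℓ] [Group G] [MulSemiringAction G R] {I : Subgroup G} {d : ℕ}
  (D : ResidueData k R ℓ I d)
  {F V : Type*} [Field F] [AddCommGroup V] [Module F V] {ρ : Representation F G V}
  {U : Submodule F V}

theorem frob_pow_mem_invariants (hφ : ∀ v ∈ U, ρ D.frob v ∈ U) (a : ℕ) {v : V} (hv : v ∈ U) :
    ρ (D.frob ^ a) v ∈ U := by
  induction a with
  | zero => simpa using hv
  | succ a ih => rw [pow_succ', map_mul]; exact hφ _ ih

/-- An element of the decomposition group which acts on `ℓ` as a power of the Frobenius element acts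
as the same power on the invariants of inertia. -/
theorem apply_eq_frob_pow_apply (hU : ∀ v, v ∈ U ↔ ∀ g ∈ I, ρ g v = v) {g : G} {a : ℕ}
    (ha : ∀ x, D.π (g • x) = D.π x ^ Fintype.card k ^ (d * a)) {v : V} (hv : v ∈ U) :
    ρ g v = ρ (D.frob ^ a) v := by
  have hmem : g⁻¹ * D.frob ^ a ∈ I := by
    refine (D.mem_inertia _).mpr fun x => ?_
    have h1 := ha ((g⁻¹ * D.frob ^ a) • x)
    rw [← mul_smul, mul_inv_cancel_left, D.π_frob_pow] at h1
    have hinj : Function.Injective fun w : ℓ => w ^ Fintype.card k ^ (d * a) := fun u v huv =>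
      ((FiniteField.frobeniusAlgHom k ℓ) ^ (d * a)).toRingHom.injective (by
        change ((FiniteField.frobeniusAlgHom k ℓ) ^ (d * a)) u =
          ((FiniteField.frobeniusAlgHom k ℓ) ^ (d * a)) v
        rwa [AlgHom.coe_pow, FiniteField.coe_frobeniusAlgHom, pow_iterate])
    exact (hinj h1).symm
  have h2 := congrArg (ρ g) ((hU v).mp hv _ hmem)
  rwa [← Module.End.mul_apply, ← map_mul, mul_inv_cancel_left, eq_comm] at h2

variable [Finite G] [Module k V]

theorem induced_term_out {f₀ : ℓ →ₗ[k] V}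
    (hf₀ : ∀ g ∈ D.decomp, ∀ x, f₀ (D.π (g • x)) = ρ g (f₀ (D.π x))) (g : G) (x : R) :
    ρ (QuotientGroup.mk g : G ⧸ D.decomp).out
      (f₀ (D.π ((QuotientGroup.mk g : G ⧸ D.decomp).out⁻¹ • x))) = ρ g (f₀ (D.π (g⁻¹ • x))) := by
  set o := (QuotientGroup.mk g : G ⧸ D.decomp).out with ho
  have hm : g⁻¹ * o ∈ D.decomp := QuotientGroup.eq.mp (QuotientGroup.out_eq' _).symm
  have h := hf₀ _ hm (o⁻¹ • x)
  rw [← mul_smul, mul_assoc, mul_inv_cancel, mul_one] at h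
  rw [h, ← Module.End.mul_apply, ← map_mul, mul_inv_cancel_left]

variable [Algebra k F] [IsScalarTower k F V] [SMulCommClass G k R]

/-- The map `R → V` induced from a map `ℓ → V`, by summing over the conjugates of `π`. -/
def induced (ρ : Representation F G V) (f₀ : ℓ →ₗ[k] V) [Fintype (G ⧸ D.decomp)] : R →ₗ[k] V where
  toFun x := ∑ c : G ⧸ D.decomp, ρ c.out (f₀ (D.π (c.out⁻¹ • x)))
  map_add' x x' := by simp only [smul_add, map_add, Finset.sum_add_distrib]
  map_smul' a x := by
    simp only [smul_comm _ a, map_smul, LinearMap.map_smul_of_tower, Finset.smul_sum,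
      RingHom.id_apply]

section Induced

variable {f₀ : ℓ →ₗ[k] V} [Fintype (G ⧸ D.decomp)]

theorem induced_mem_equivariantHom
    (hf₀ : ∀ g ∈ D.decomp, ∀ x, f₀ (D.π (g • x)) = ρ g (f₀ (D.π x))) :
    D.induced ρ f₀ ∈ equivariantHom k ρ R := fun g x => by
  change ∑ c : G ⧸ D.decomp, ρ c.out (f₀ (D.π (c.out⁻¹ • g • x))) =
    ρ g (∑ c : G ⧸ D.decomp, ρ c.out (f₀ (D.π (c.out⁻¹ • x))))
  rw [map_sum, ← Equiv.sum_comp (MulAction.toPerm g : Equiv.Perm (G ⧸ D.decomp))]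
  refine Finset.sum_congr rfl fun c _ => ?_
  have hc : MulAction.toPerm g c = (QuotientGroup.mk (g * c.out) : G ⧸ D.decomp) := by
    conv_lhs => rw [← QuotientGroup.out_eq' c]
    rfl
  rw [hc, D.induced_term_out hf₀, mul_inv_rev, mul_smul, inv_smul_smul, map_mul,
    Module.End.mul_apply]

theorem induced_apply_of_mem_supp
    (hf₀ : ∀ g ∈ D.decomp, ∀ x, f₀ (D.π (g • x)) = ρ g (f₀ (D.π x))) {x : R} (hx : x ∈ D.supp) :
    D.induced ρ f₀ x = f₀ (D.π x) := by
  classical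
  change ∑ c : G ⧸ D.decomp, ρ c.out (f₀ (D.π (c.out⁻¹ • x))) = _
  rw [Finset.sum_eq_single (QuotientGroup.mk 1)]
  · rw [D.induced_term_out hf₀]
    simp
  · intro c _ hc
    rw [hx, map_zero, map_zero]
    refine fun hm => hc ?_
    rw [← QuotientGroup.out_eq' c]
    exact QuotientGroup.eq.mpr (by rwa [mul_one])
  · exact fun hn => absurd (Finset.mem_univ _) hn

theorem induced_apply_of_mem_rad {x : R} (hx : x ∈ D.rad) : D.induced ρ f₀ x = 0 := by
  change ∑ c : G ⧸ D.decomp, ρ c.out (f₀ (D.π (c.out⁻¹ • x))) = _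
  exact Finset.sum_eq_zero fun c _ => by rw [hx, map_zero, map_zero]

end Induced

/-- The values of an equivariant map on the powers of a lift of a normal basis generator can be
prescribed in the invariants of inertia. -/
theorem exists_map_pow_eq [NeZero d] [FiniteDimensional k ℓ] (hU : ∀ v, v ∈ U ↔ ∀ g ∈ I, ρ g v = v)
    (hφ : ∀ v ∈ U, ρ D.frob v ∈ U) {y : ℓ}
    (b : Module.Basis (Fin (Module.finrank k ℓ)) k ℓ)
    (hb : ∀ i, b i = y ^ Fintype.card k ^ i.1) {x : R} (hx : x ∈ D.supp)
    (hxy : D.π x = y) (h : Fin d → U) :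
    ∃ f ∈ equivariantHom k ρ R, (∀ x ∈ D.rad, f x = 0) ∧
      ∀ i : Fin d, f (x ^ Fintype.card k ^ i.1) = h i := by
  classical
  have := Fintype.ofFinite (G ⧸ D.decomp)
  have hd : 0 < d := Nat.pos_of_ne_zero (NeZero.ne d)
  obtain ⟨s, hs⟩ := D.dvd
  let m := Module.finrank k ℓ
  have hm : 0 < m := Module.finrank_pos
  have hℓ : ∀ w : ℓ, w ^ Fintype.card k ^ m = w := fun w => by
    have : Finite ℓ := Module.finite_of_finite k
    have := Fintype.ofFinite ℓ
    rw [← Module.card_eq_pow_finrank, FiniteField.pow_card]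
  -- the extension of `h` to a function on `ℕ` compatible with the Frobenius element
  let H : ℕ → V := fun i => ρ (D.frob ^ (i / d)) (h ⟨i % d, Nat.mod_lt _ hd⟩)
  have hHU (i : ℕ) : H i ∈ U := D.frob_pow_mem_invariants hφ _ (h _).2
  have hHadd (i a : ℕ) : H (i + d * a) = ρ (D.frob ^ a) (H i) := by
    simp only [H, Nat.add_mul_div_left _ _ hd, Nat.add_mul_mod_self_left]
    rw [add_comm, pow_add, map_mul, Module.End.mul_apply]
  have hHper : Function.Periodic H m := fun i => by
    have hfix : ∀ x, D.π (D.frob ^ s • x) = D.π x := fun x => by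
      rw [D.π_frob_pow, ← hs]
      exact hℓ _
    change H (i + Module.finrank k ℓ) = H i
    rw [hs, hHadd]
    exact (hU _).mp (hHU i) _ ((D.mem_inertia _).mpr hfix)
  let f₀ : ℓ →ₗ[k] V := b.constr k fun i => H i.1
  have hf₀ (i : ℕ) : f₀ (y ^ Fintype.card k ^ i) = H i := by
    have h1 (j a : ℕ) : y ^ Fintype.card k ^ (j + m * a) = y ^ Fintype.card k ^ j := by
      induction a with
      | zero => simp
      | succ a ih => rw [mul_add, mul_one, ← add_assoc, pow_add, pow_mul, hℓ, ih]
    rw [← hHper.map_mod_nat, ← Nat.mod_add_div i m, h1, Nat.add_mul_mod_self_left, Nat.mod_mod,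
      ← hb ⟨i % m, Nat.mod_lt _ hm⟩, b.constr_basis]
  have hequiv : ∀ g ∈ D.decomp, ∀ x, f₀ (D.π (g • x)) = ρ g (f₀ (D.π x)) := fun g hg x => by
    obtain ⟨a, ha⟩ := D.exists_pow g hg
    have hlin : f₀ ∘ₗ ((FiniteField.frobeniusAlgHom k ℓ) ^ (d * a)).toLinearMap =
        ((ρ g).restrictScalars k) ∘ₗ f₀ := by
      refine b.ext fun i => ?_
      simp only [LinearMap.comp_apply, AlgHom.toLinearMap_apply, AlgHom.coe_pow,
        FiniteField.coe_frobeniusAlgHom, pow_iterate, LinearMap.restrictScalars_apply]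
      rw [hb, ← pow_mul, ← pow_add, hf₀, hf₀, hHadd, D.apply_eq_frob_pow_apply hU ha (hHU _)]
    have := LinearMap.congr_fun hlin (D.π x)
    simp only [LinearMap.comp_apply, AlgHom.toLinearMap_apply, AlgHom.coe_pow,
      FiniteField.coe_frobeniusAlgHom, pow_iterate, LinearMap.restrictScalars_apply] at this
    rw [ha, this]
  refine ⟨D.induced ρ f₀, D.induced_mem_equivariantHom hequiv,
    fun x hx => D.induced_apply_of_mem_rad hx, fun i => ?_⟩
  rw [D.induced_apply_of_mem_supp hequiv
    (Ideal.pow_mem_of_mem _ hx _ (pow_pos Fintype.card_pos _)), map_pow, hxy, hf₀]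
  simp only [H, Nat.div_eq_of_lt i.2, Nat.mod_eq_of_lt i.2, pow_zero, map_one, Module.End.one_apply]

/-- Up to a nilpotent part, the transpose of the `q`-power Frobenius on `V* ⊗_{k[G]} R` is the cyclic
shift of `U ^ d`, where `U` is the space of invariants of inertia, closed up by the Frobenius
element. -/
theorem exists_cyclicShift_embedding [NeZero d] [FiniteDimensional k ℓ] [FiniteDimensional F V]
    (hU : ∀ v, v ∈ U ↔ ∀ g ∈ I, ρ g v = v) (φ : Module.End F U)
    (hφ : ∀ u, (φ u : V) = ρ D.frob u) :
    ∃ Γ : (Fin d → U) →ₗ[F] Module.Dual F (BalancedTensor k (dualRight ρ) R),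
      Function.Injective Γ ∧
      Γ ∘ₗ cyclicShift d φ =
        (balancedMap (dualRight ρ) (frobT k R) frobT_smul).dualMap ∘ₗ Γ ∧
      ∃ N, ∀ ξ, (((balancedMap (dualRight ρ) (frobT k R) frobT_smul).dualMap :
        Module.End F (Module.Dual F (BalancedTensor k (dualRight ρ) R))) ^ N) ξ ∈
          LinearMap.range Γ := by
  have hd : 0 < d := Nat.pos_of_ne_zero (NeZero.ne d)
  obtain ⟨y, b, hb⟩ := exists_normalBasis_pow k ℓ
  obtain ⟨x, hx, hxy⟩ := D.exists_mem_supp y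
  have hpow (i : ℕ) : x ^ Fintype.card k ^ i ∈ D.supp :=
    Ideal.pow_mem_of_mem _ hx _ (pow_pos Fintype.card_pos _)
  let W : Submodule F (equivariantHom k ρ R) :=
    { carrier := {f | ∀ x ∈ D.rad, f.1 x = 0}
      zero_mem' := fun _ _ => rfl
      add_mem' := fun {f f'} hf hf' x hx => by
        change f.1 x + f'.1 x = 0
        rw [hf x hx, hf' x hx, add_zero]
      smul_mem' := fun c f hf x hx => by
        change c • f.1 x = 0
        rw [hf x hx, smul_zero] }
  let Ψ : W →ₗ[F] (Fin d → U) :=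
    { toFun := fun f i => ⟨f.1.1 (x ^ Fintype.card k ^ i.1),
        D.map_mem_invariants hU f.1.2 f.2 (hpow i.1)⟩
      map_add' := fun _ _ => rfl
      map_smul' := fun _ _ => rfl }
  have hΨ : Function.Bijective Ψ := by
    constructor
    · refine (injective_iff_map_eq_zero _).mpr fun f hf => ?_
      refine Subtype.ext (Subtype.ext ?_)
      exact D.eq_zero_of_map_pow_eq_zero b hb f.1.2 f.2 hx hxy fun i hi =>
        congrArg Subtype.val (congrFun hf ⟨i, hi⟩)
    · intro h
      obtain ⟨f, hf, hrad, hfh⟩ := D.exists_map_pow_eq hU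
        (fun v hv => hφ ⟨v, hv⟩ ▸ (φ ⟨v, hv⟩).2) b hb hx hxy h
      exact ⟨⟨⟨f, hf⟩, hrad⟩, funext fun i => Subtype.ext (hfh i)⟩
  let Ψe : W ≃ₗ[F] (Fin d → U) := LinearEquiv.ofBijective Ψ hΨ
  -- precomposition with the Frobenius of `R`
  let T (f : equivariantHom k ρ R) : equivariantHom k ρ R :=
    ⟨f.1 ∘ₗ frobT k R, fun g x => by
      rw [LinearMap.comp_apply, frobT_smul, f.2]
      rfl⟩
  have hT (f : equivariantHom k ρ R) : dualPairing ρ R (T f) =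
      (balancedMap (dualRight ρ) (frobT k R) frobT_smul).dualMap (dualPairing ρ R f) :=
    BalancedTensor.hom_ext fun _ _ => rfl
  have hTW (f : W) : T f.1 ∈ W := fun x hx =>
    f.2 _ (Ideal.pow_mem_of_mem _ hx _ Fintype.card_pos)
  have hΨT (f : W) : Ψ ⟨T f.1, hTW f⟩ = cyclicShift d φ (Ψ f) := by
    funext i
    apply Subtype.ext
    have h1 : (Ψ ⟨T f.1, hTW f⟩ i : V) = f.1.1 (x ^ Fintype.card k ^ (i.1 + 1)) := by
      rw [pow_succ, pow_mul]
      rfl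
    rw [h1]
    simp only [cyclicShift, LinearMap.coe_mk, AddHom.coe_mk]
    split_ifs with hi
    · rfl
    · have hid : i.1 + 1 = d := by
        have := i.2
        lia
      rw [hid, D.map_frob_smul f.2 hx, f.1.2, hφ]
      have h2 : (Ψ f 0 : V) = f.1.1 x := by
        change f.1.1 (x ^ Fintype.card k ^ 0) = _
        rw [pow_zero, pow_one]
      rw [h2]
  let Γ : (Fin d → U) →ₗ[F] Module.Dual F (BalancedTensor k (dualRight ρ) R) :=
    dualPairing ρ R ∘ₗ W.subtype ∘ₗ Ψe.symm.toLinearMap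
  have hΓ (f : W) : Γ (Ψ f) = dualPairing ρ R f.1 := by
    have : Ψe.symm (Ψ f) = f := Ψe.symm_apply_apply f
    change dualPairing ρ R (Ψe.symm (Ψ f)).1 = _
    rw [this]
  refine ⟨Γ, ?_, ?_, ?_⟩
  · exact dualPairing_injective.comp (Subtype.val_injective.comp Ψe.symm.injective)
  · refine LinearMap.ext fun h => ?_
    obtain ⟨f, rfl⟩ := hΨ.2 h
    change Γ (cyclicShift d φ (Ψ f)) =
      (balancedMap (dualRight ρ) (frobT k R) frobT_smul).dualMap (Γ (Ψ f))
    rw [← hΨT, hΓ, hΓ, hT]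
  · obtain ⟨N, hN⟩ := D.exists_pow_eq_zero
    refine ⟨N, fun ξ => ?_⟩
    obtain ⟨f, rfl⟩ := dualPairing_surjective ξ
    have hiter : ∀ j, ∃ f' : equivariantHom k ρ R,
        (∀ x, f'.1 x = f.1 (x ^ Fintype.card k ^ j)) ∧ dualPairing ρ R f' =
          (((balancedMap (dualRight ρ) (frobT k R) frobT_smul).dualMap :
            Module.End F (Module.Dual F (BalancedTensor k (dualRight ρ) R))) ^ j)
              (dualPairing ρ R f) := fun j => by
      induction j with
      | zero => exact ⟨f, by simp, by simp⟩
      | succ j ih =>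
        obtain ⟨f', h1, h2⟩ := ih
        refine ⟨T f', fun x => ?_, ?_⟩
        · change f'.1 (x ^ Fintype.card k) = _
          rw [h1, ← pow_mul, ← pow_succ']
        · rw [hT, h2, pow_succ', Module.End.mul_apply]
    obtain ⟨f', h1, h2⟩ := hiter N
    refine ⟨Ψ ⟨f', fun x hx => ?_⟩, ?_⟩
    · rw [h1, hN x hx, map_zero]
    · rw [hΓ, h2]

end ResidueData

/-! ### The determinant of a cyclic shift -/

section CyclicShift

variable {F U : Type*} [Field F] [AddCommGroup U] [Module F U] (d : ℕ) [NeZero d]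

theorem cyclicShift_eq_add (φ : Module.End F U) :
    cyclicShift d φ = cyclicShift d 0 + coordIncl F d U d ∘ₗ φ ∘ₗ coordProj F d U := by
  refine LinearMap.ext fun h => ?_
  funext i
  have hi := i.2
  simp only [cyclicShift, coordIncl, coordProj, LinearMap.coe_mk, AddHom.coe_mk,
    LinearMap.add_apply, LinearMap.comp_apply, LinearMap.proj_apply, Pi.add_apply]
  split_ifs <;> first | omega | simp

theorem cyclicShift_zero_comp_coordIncl {j : ℕ} (hj : j < d) :
    cyclicShift d (0 : Module.End F U) ∘ₗ coordIncl F d U (j + 1) = coordIncl F d U j := by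
  ext1 u
  funext i
  have hi := i.2
  simp only [cyclicShift, coordIncl, LinearMap.coe_mk, AddHom.coe_mk, LinearMap.comp_apply]
  split_ifs <;> first | omega | simp

theorem isNilpotent_cyclicShift_zero : IsNilpotent (cyclicShift d (0 : Module.End F U)) := by
  have h : ∀ (j : ℕ) (f : Fin d → U) (i : Fin d), ((cyclicShift d (0 : Module.End F U)) ^ j) f i =
      if hi : i.1 + j < d then f ⟨i.1 + j, hi⟩ else 0 := fun j => by
    induction j with
    | zero => simp
    | succ j ih =>
      intro f i
      rw [pow_succ, Module.End.mul_apply, ih]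
      simp only [cyclicShift, LinearMap.coe_mk, AddHom.coe_mk]
      split_ifs <;> first | omega | simp [add_assoc]
  refine ⟨d, ?_⟩
  refine LinearMap.ext fun f => ?_
  funext i
  rw [h, dif_neg (by lia)]
  rfl

theorem det_one_sub_smul_cyclicShift [FiniteDimensional F U] (φ : Module.End F U)
    (E : Type*) [Field E] [Algebra F E] {c : E} (hc : c ≠ 0) :
    LinearMap.det (1 - c • (cyclicShift d φ).baseChange E) =
      LinearMap.det (1 - c ^ d • φ.baseChange E) := by
  let S₀ : Module.End F (Fin d → U) := cyclicShift d 0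
  let Φ : Module.End E (E ⊗[F] (Fin d → U)) := c⁻¹ • (1 : Module.End E _) - S₀.baseChange E
  have h1 : LinearMap.det Φ = c⁻¹ ^ Module.finrank F (Fin d → U) := by
    refine (det_smul_sub_baseChange E S₀ c⁻¹).trans ?_
    rw [(isNilpotent_cyclicShift_zero d).charpoly_eq_X_pow_finrank, map_pow, Polynomial.aeval_X]
  have h2 := det_companion (Φ := Φ) (κ := fun j => (coordIncl F d U j).baseChange E)
    (π := (coordProj F d U).baseChange E) (y := algebraMap E _ c⁻¹) (a := algebraMap E _ c)
    (Nat.pos_of_ne_zero (NeZero.ne d)) (by simp only [coordIncl_zero, LinearMap.baseChange_zero])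
    (fun j hj => ?_) (by rw [← map_mul, inv_mul_cancel₀ hc, map_one])
    (by rw [← LinearMap.baseChange_comp, coordProj_comp_coordIncl_one, LinearMap.baseChange_id]; rfl)
    (fun j hj hj0 => by
      rw [← LinearMap.baseChange_comp, coordProj_comp_coordIncl d hj0, LinearMap.baseChange_zero])
    (φ.baseChange E)
  · have h3 : 1 - c • (cyclicShift d φ).baseChange E =
        c • (Φ - (coordIncl F d U d).baseChange E ∘ₗ φ.baseChange E ∘ₗ
          (coordProj F d U).baseChange E) := by
      rw [cyclicShift_eq_add, LinearMap.baseChange_add, LinearMap.baseChange_comp,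
        LinearMap.baseChange_comp]
      refine Eq.trans ?_ (congrArg (c • ·) (sub_sub
        (_ : Module.End E (E ⊗[F] (Fin d → U))) _ _).symm)
      refine Eq.trans ?_ (smul_sub c (_ : Module.End E (E ⊗[F] (Fin d → U))) _).symm
      rw [smul_smul, mul_inv_cancel₀ hc, one_smul]
    rw [h3, LinearMap.det_smul, h2, h1, ← mul_assoc, Module.finrank_baseChange, ← mul_pow,
      mul_inv_cancel₀ hc, one_pow, one_mul]
    congr 2
    rw [← map_pow, Algebra.smul_def]
  · rw [LinearMap.sub_comp, ← LinearMap.baseChange_comp, cyclicShift_zero_comp_coordIncl d hj]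
    congr 1
    ext m
    simp

end CyclicShift

/-! ### The local identity over a ring with residue data -/

section LocalFactor

variable {k : Type*} [Field k] [Fintype k] (n : ℕ) [NeZero n]
variable {R : Type*} [CommRing R] [Algebra k R] [Algebra k[X] R] [IsScalarTower k k[X] R]
variable {G : Type*} [Group G] [Finite G] [MulSemiringAction G R] [SMulCommClass G k[X] R]
  [SMulCommClass G k R]
variable {F V : Type*} [Field F] [Algebra k F] [AddCommGroup V] [Module F V] [Module k V]
  [IsScalarTower k F V] [FiniteDimensional F V] [Module.Finite k R] {ρ : Representation F G V}
  {U : Submodule F V} {κ ℓ : Type*} [Field κ] [Algebra k κ] [FiniteDimensional k κ] [Algebra κ R]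
  [IsScalarTower k κ R] [Field ℓ] [Algebra k ℓ] [FiniteDimensional k ℓ] {I : Subgroup G}

/-- The local identity: the ratio of the characteristic polynomials of `V* ⊗ C^{⊗n}(R)` and of its
Lie algebra is the Euler factor. -/
theorem aeval_charPoly_carlitz_eq_mul_det (D : ResidueData k R ℓ I (Module.finrank k κ))
    (hU : ∀ v, v ∈ U ↔ ∀ g ∈ I, ρ g v = v) (φ : Module.End F U)
    (hφ : ∀ u, (φ u : V) = ρ D.frob u) {z : κ}
    (hz : algebraMap κ R z = algebraMap k[X] R Polynomial.X)
    {E : Type*} [Field E] [Algebra F E] {x : E}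
    (hx : ∀ P : F[X], P.Monic → Polynomial.aeval x P ≠ 0) :
    Polynomial.aeval x (charPoly
        (balancedTensorAction k (dualRight ρ) (carlitz k n R) (carlitz_smul k n R))) =
      Polynomial.aeval x (charPoly
        (balancedTensorAction k (dualRight ρ) (lie k n R) (lie_smul k n R))) *
      LinearMap.det (1 - ((Polynomial.aeval x
        ((Algebra.lmul k κ z).charpoly.map (algebraMap k F))) ^ n)⁻¹ • φ.baseChange E) := by
  have : NeZero (Module.finrank k κ) := ⟨Module.finrank_pos.ne'⟩
  let A := AlgebraicClosure E
  let : Algebra k A := ((algebraMap F A).comp (algebraMap k F)).toAlgebra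
  have : IsScalarTower k F A := .of_algebraMap_eq fun _ => rfl
  have hxA (P : F[X]) : Polynomial.aeval (algebraMap E A x) P =
      algebraMap E A (Polynomial.aeval x P) := Polynomial.aeval_algebraMap_apply A x P
  obtain ⟨c, hc, h⟩ := exists_aeval_charPoly_carlitz n (dualRight ρ) hz (x := algebraMap E A x)
    fun P hP => by
      rw [hxA]
      exact (map_ne_zero _).mpr (hx P hP)
  have hc0 : c ≠ 0 := by
    rintro rfl
    rw [zero_pow Module.finrank_pos.ne', zero_mul] at hc
    exact zero_ne_one hc
  have hcd : c ^ Module.finrank k κ = algebraMap E A ((Polynomial.aeval x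
      ((Algebra.lmul k κ z).charpoly.map (algebraMap k F))) ^ n)⁻¹ := by
    rw [map_inv₀, map_pow, ← hxA, Polynomial.aeval_map_algebraMap]
    exact eq_inv_of_mul_eq_one_left hc
  obtain ⟨Γ, hΓ, hΓs, N, hN⟩ := D.exists_cyclicShift_embedding (F := F) hU φ hφ
  let τ : Module.End F (BalancedTensor k (dualRight ρ) R) :=
    balancedMap (dualRight ρ) (frobT k R) frobT_smul
  have h1 : LinearMap.det (1 - c • τ.baseChange A) =
      algebraMap E A (LinearMap.det (1 - ((Polynomial.aeval x
        ((Algebra.lmul k κ z).charpoly.map (algebraMap k F))) ^ n)⁻¹ • φ.baseChange E)) := by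
    rw [det_one_sub_smul_baseChange, ← charpoly_dualMap, ← det_one_sub_smul_baseChange,
      det_one_sub_smul_baseChange_of_injective A hΓ hΓs hN, det_one_sub_smul_cyclicShift _ _ _ hc0,
      det_one_sub_smul_baseChange, det_one_sub_smul_baseChange, hcd,
      Polynomial.aeval_algebraMap_apply]
  rw [hxA, hxA] at h
  apply (algebraMap E A).injective
  rw [map_mul, ← h1]
  exact h

end LocalFactor

/-! ### Finiteness of the quotients of rings of integers -/

section FiniteQuotients

variable {k : Type*} [Field k] [Finite k]

theorem finite_quotient_polynomial {I : Ideal k[X]} (hI : I ≠ ⊥) : Finite (k[X] ⧸ I) := by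
  obtain ⟨f, hf⟩ := (IsPrincipalIdealRing.principal I).principal
  have hf0 : f ≠ 0 := by rintro rfl; apply hI; rw [hf]; simp
  have hp : I = Ideal.span {f} := hf
  rw [hp]
  have : Module.Finite k (AdjoinRoot f) := (AdjoinRoot.powerBasis hf0).finite
  exact (Module.finite_of_finite k : Finite (AdjoinRoot f))

variable {L : Type*} [Field L] [Algebra (RatFunc k) L] [FiniteDimensional (RatFunc k) L]
  [Algebra k[X] L] [IsScalarTower k[X] (RatFunc k) L]

theorem finite_intClosure_quotient_of_isMaximal (p : Ideal k[X]) [p.IsMaximal] :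
    Finite (IntClosure k L ⧸ p.map (algebraMap k[X] (IntClosure k L))) := by
  have hp0 : p ≠ ⊥ := by
    rintro rfl
    exact Polynomial.not_isField k (Ring.isField_iff_maximal_bot.mpr ‹_›)
  have := finite_quotient_polynomial hp0
  let : Field (k[X] ⧸ p) := Ideal.Quotient.field p
  set P := p.map (algebraMap k[X] (IntClosure k L)) with hP
  let : Algebra (k[X] ⧸ p) (IntClosure k L ⧸ P) :=
    Ideal.Quotient.algebraQuotientOfLEComap Ideal.le_comap_map
  have : Module.Free (k[X] ⧸ p) (IntClosure k L ⧸ P) := Module.Free.of_divisionRing _ _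
  have : Module.Finite (k[X] ⧸ p) (IntClosure k L ⧸ P) := by
    -- A basis over `k[t] / p` lifts to a family which is linearly independent over `k(t)`.
    let b := Module.Free.chooseBasis (k[X] ⧸ p) (IntClosure k L ⧸ P)
    let b' := fun i => (Ideal.Quotient.mk_surjective (b i)).choose
    have e : ⇑b = ((Submodule.mkQ P).restrictScalars k[X]) ∘ b' :=
      funext fun i => (Ideal.Quotient.mk_surjective (b i)).choose_spec.symm
    have hb := b.linearIndependent
    rw [e] at hb
    have : IsScalarTower k[X] (k[X] ⧸ p) (IntClosure k L ⧸ P) := .of_algebraMap_eq fun _ => rfl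
    have := Ideal.FinrankQuotientMap.linearIndependent_of_nontrivial (S := k[X] ⧸ p) (RatFunc k) (by
      rw [Ideal.Quotient.algebraMap_eq, Ideal.mk_ker]; exact Ideal.IsPrime.ne_top inferInstance)
      ((Algebra.linearMap (IntClosure k L) L).restrictScalars k[X]) (fun _ _ h => Subtype.ext h) _ hb
    have := this.finite
    exact Module.Finite.of_basis b
  exact Module.finite_of_finite (k[X] ⧸ p)

theorem finite_intClosure_quotient_span {f : k[X]} (hf : f ≠ 0) :
    Finite (IntClosure k L ⧸ Ideal.span {algebraMap k[X] (IntClosure k L) f}) := by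
  induction f using UniqueFactorizationMonoid.induction_on_prime with
  | h₁ => exact absurd rfl hf
  | h₂ x hx =>
    rw [Ideal.span_singleton_eq_top.mpr (hx.map _)]
    infer_instance
  | h₃ a p ha hp ih =>
    have := ih ha
    have : (Ideal.span {p}).IsMaximal := PrincipalIdealRing.isMaximal_of_irreducible hp.irreducible
    have := finite_intClosure_quotient_of_isMaximal (L := L) (Ideal.span {p})
    rw [Ideal.map_span, Set.image_singleton] at this
    rw [map_mul, ← Ideal.span_singleton_mul_span_singleton]
    exact Submodule.finite_quotient_smul _ (Submodule.fg_span_singleton _)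

/-- The nonzero ideals of the integral closure of `k[t]` in a finite extension of `k(t)`, separable
or not, have finite index. -/
theorem hasFiniteQuotients_intClosure : Ring.HasFiniteQuotients (IntClosure k L) where
  finiteQuotient {I} hI := by
    have h : I.comap (algebraMap k[X] (IntClosure k L)) ≠ ⊥ := fun h =>
      hI (Ideal.eq_bot_of_comap_eq_bot h)
    obtain ⟨f, hf, hf0⟩ := Submodule.exists_mem_ne_zero_of_ne_bot h
    have := finite_intClosure_quotient_span (L := L) hf0
    exact Finite.of_surjective _ (Ideal.Quotient.factor_surjective
      ((Ideal.span_singleton_le_iff_mem I).mpr hf))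

end FiniteQuotients

/-! ### Residue data from a maximal ideal of an extension of invariants -/

section ResidueData

variable {k A B G : Type*} [Field k] [Fintype k] [CommRing A] [CommRing B] [Algebra k A]
  [Algebra k B] [Algebra A B] [IsScalarTower k A B] [Group G] [MulSemiringAction G B]
  [SMulCommClass G A B]

open scoped Pointwise in
/-- If `B ^ G = A`, then the primes of `B` above a maximal ideal `p` of `A` are conjugate, and so an
element of `B` all of whose conjugates lie in one of them is nilpotent modulo `pB`. -/
theorem isNilpotent_mk_of_smul_mem [Finite G] [Algebra.IsInvariant A B G] (p : Ideal A)
    [p.IsMaximal] (P : Ideal B) [P.IsPrime] [P.LiesOver p] {x : B} (hx : ∀ g : G, g • x ∈ P) :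
    IsNilpotent (Ideal.Quotient.mk (p.map (algebraMap A B)) x) := by
  rw [← mem_nilradical, nilradical_eq_sInf, Ideal.mem_sInf]
  intro Q hQ
  have hQ' : Q.IsPrime := hQ
  rw [← Ideal.mem_comap]
  set Q₀ := Q.comap (Ideal.Quotient.mk (p.map (algebraMap A B))) with hQ₀
  have : Q₀.IsPrime := Ideal.comap_isPrime _ _
  have hle : p.map (algebraMap A B) ≤ Q₀ := fun y hy => by
    rw [hQ₀, Ideal.mem_comap, Ideal.Quotient.eq_zero_iff_mem.mpr hy]
    exact zero_mem _
  have hu : Q₀.under A = P.under A := by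
    rw [← Ideal.LiesOver.over (P := P) (p := p)]
    refine (Ideal.IsMaximal.eq_of_le ‹_› (Ideal.IsPrime.ne_top inferInstance)
      (Ideal.map_le_iff_le_comap.mp hle)).symm
  obtain ⟨g, hg⟩ := Algebra.IsInvariant.exists_smul_of_under_eq A B G P Q₀ hu.symm
  rw [hg, Ideal.mem_pointwise_smul_iff_inv_smul_mem]
  exact hx _

variable (p : Ideal A) [p.IsMaximal] (P : Ideal B) [P.IsMaximal] [P.LiesOver p]

/-- An element of the decomposition group of `P` acts on `B / P` through a power of the Frobenius
automorphism over `A / p`. -/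
theorem exists_mk_smul_eq_pow [Finite (B ⧸ P)] (g : G) (hg : ∀ x ∈ P, g • x ∈ P) :
    ∃ a : ℕ, ∀ x : B, Ideal.Quotient.mk P (g • x) =
      Ideal.Quotient.mk P x ^ Nat.card (A ⧸ p) ^ a := by
  let : Field (A ⧸ p) := Ideal.Quotient.field p
  let : Field (B ⧸ P) := Ideal.Quotient.field P
  have : Finite (A ⧸ p) := Finite.of_injective _ (algebraMap (A ⧸ p) (B ⧸ P)).injective
  have := Fintype.ofFinite (A ⧸ p)
  let γ : (B ⧸ P) →ₐ[A ⧸ p] (B ⧸ P) :=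
    { Ideal.quotientMap P (MulSemiringAction.toRingHom G B g) hg with
      commutes' := fun r => by
        obtain ⟨r, rfl⟩ := Ideal.Quotient.mk_surjective r
        exact congrArg (Ideal.Quotient.mk P) (smul_algebraMap g r) }
  obtain ⟨a, ha⟩ := (FiniteField.bijective_frobeniusAlgHom_pow (A ⧸ p) (B ⧸ P)).2 γ
  refine ⟨a.1, fun x => ?_⟩
  have h := DFunLike.congr_fun ha (Ideal.Quotient.mk P x)
  simp only [AlgHom.coe_pow, FiniteField.coe_frobeniusAlgHom, pow_iterate] at h
  rw [Nat.card_eq_fintype_card, h]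
  rfl

variable [Finite (B ⧸ P)] [Finite (B ⧸ p.map (algebraMap A B))]

open Ideal.Quotient in
/-- The residue data of `B / pB`, as an algebra over a finite field `k`, at a maximal ideal `P` above
`p` with a Frobenius element `σ`. -/
def residueData [Finite G] [Algebra.IsInvariant A B G] (σ : G) (hσ : IsArithFrobAt A σ P) :
    letI : Field (A ⧸ p) := Ideal.Quotient.field p
    letI : Field (B ⧸ P) := Ideal.Quotient.field P
    ResidueData k (B ⧸ p.map (algebraMap A B)) (B ⧸ P) (P.inertia G)
      (Module.finrank k (A ⧸ p)) :=
  letI : Field (A ⧸ p) := Ideal.Quotient.field p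
  letI : Field (B ⧸ P) := Ideal.Quotient.field P
  have hle : p.map (algebraMap A B) ≤ P :=
    Ideal.map_le_iff_le_comap.mpr (Ideal.LiesOver.over (P := P) (p := p)).le
  have hcard : Nat.card (A ⧸ p) = Fintype.card k ^ Module.finrank k (A ⧸ p) := by
    have : Finite (A ⧸ p) := Finite.of_injective _ (algebraMap (A ⧸ p) (B ⧸ P)).injective
    rw [Module.natCard_eq_pow_finrank (K := k), Nat.card_eq_fintype_card]
  { π := Ideal.Quotient.factorₐ k hle
    surjective := Ideal.Quotient.factor_surjective hle
    frob := σ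
    π_frob := fun x => by
      obtain ⟨x, rfl⟩ := mk_surjective x
      rw [← hcard]
      have h := AlgHom.IsArithFrobAt.mk_apply hσ x
      rw [← Ideal.LiesOver.over (P := P) (p := p)] at h
      exact h
    exists_pow := fun g hg => by
      obtain ⟨a, ha⟩ := exists_mk_smul_eq_pow p P g fun x hx => eq_zero_iff_mem.mp
        (hg (Ideal.Quotient.mk _ x) (eq_zero_iff_mem.mpr hx))
      refine ⟨a, fun x => ?_⟩
      obtain ⟨x, rfl⟩ := mk_surjective x
      rw [pow_mul, ← hcard]
      exact ha x
    mem_inertia := fun g => by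
      rw [mk_surjective.forall]
      refine (AddSubgroup.mem_inertia).trans (forall_congr' fun x => ?_)
      exact Ideal.Quotient.eq.symm
    exists_pow_eq_zero := by
      obtain ⟨N, hN⟩ :=
        IsArtinianRing.isNilpotent_nilradical (R := B ⧸ p.map (algebraMap A B))
      refine ⟨N, fun x hx => ?_⟩
      obtain ⟨x, rfl⟩ := mk_surjective x
      have h := Ideal.pow_mem_pow (mem_nilradical.mpr (isNilpotent_mk_of_smul_mem p P (x := x)
        fun g => eq_zero_iff_mem.mp (hx g))) N
      rw [hN] at h
      -- `N ≤ q ^ N`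
      exact pow_eq_zero_of_le (Nat.lt_pow_self Fintype.one_lt_card).le h
    dvd := by
      have : IsScalarTower k (A ⧸ p) (B ⧸ P) := .of_algebraMap_eq fun x =>
        congrArg (Ideal.Quotient.mk P) (IsScalarTower.algebraMap_apply k A B x)
      exact ⟨_, (Module.finrank_mul_finrank k (A ⧸ p) (B ⧸ P)).symm⟩ }

end ResidueData

/-! ### Instances for rings of integers -/

section Rings

variable {k K L : Type*} [Field k] [Field K] [Field L] [Algebra k[X] K] [Algebra k[X] L]
  [Algebra K L] [IsScalarTower k[X] K L]

instance isScalarTower_intClosure : IsScalarTower k[X] (IntClosure k K) (IntClosure k L) :=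
  .of_algebraMap_eq fun x => Subtype.ext (IsScalarTower.algebraMap_apply k[X] K L x)

instance isScalarTower_base_intClosure [Algebra k K] [IsScalarTower k k[X] K] [Algebra k L]
    [IsScalarTower k k[X] L] : IsScalarTower k (IntClosure k K) (IntClosure k L) :=
  .of_algebraMap_eq fun x => by
    rw [IsScalarTower.algebraMap_apply k k[X] (IntClosure k L),
      IsScalarTower.algebraMap_apply k[X] (IntClosure k K) (IntClosure k L),
      ← IsScalarTower.algebraMap_apply k k[X] (IntClosure k K)]

instance isInvariant_intClosure [FiniteDimensional K L] [IsGalois K L] :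
    Algebra.IsInvariant (IntClosure k K) (IntClosure k L) Gal(L/K) where
  isInvariant b hb := by
    obtain ⟨a, ha⟩ :=
      (IsGalois.mem_bot_iff_fixed (F := K) (b : L)).mpr fun g => congrArg Subtype.val (hb g)
    have hi : IsIntegral k[X] a := by
      rw [← isIntegral_algebraMap_iff (algebraMap K L).injective]
      have := b.2
      rw [← ha] at this
      exact this
    exact ⟨⟨a, hi⟩, Subtype.ext ha⟩

instance isIntegral_intClosure :
    Algebra.IsIntegral (IntClosure k K) (IntClosure k L) := Algebra.IsIntegral.tower_top k[X]

theorem ne_bot_of_maximalSpectrum (p : MaximalSpectrum (IntClosure k K))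
    (h : Function.Injective (algebraMap k[X] K)) : p.asIdeal ≠ ⊥ := by
  intro hp
  have := p.isMaximal
  rw [hp] at this
  have h' := Ideal.isMaximal_comap_of_isIntegral_of_isMaximal (R := k[X])
    (⊥ : Ideal (IntClosure k K))
  rw [← RingHom.ker_eq_comap_bot, (RingHom.injective_iff_ker_eq_bot _).mp
    (fun x y hxy => h (congrArg Subtype.val hxy))] at h'
  exact Polynomial.not_isField k (Ring.isField_iff_maximal_bot.mpr h')

end Rings

/-! ### The local identity for rings of integers -/

section LocalFactor

/-- `|κ|_{k[t]}` is the characteristic polynomial of the image of `t`. -/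
theorem charPoly_lsmul {k : Type*} [Field k] (κ : Type*) [CommRing κ] [Algebra k κ] [Algebra k[X] κ]
    [IsScalarTower k k[X] κ] [FiniteDimensional k κ] :
    charPoly ((Algebra.lsmul k k κ).comp (IsScalarTower.toAlgHom k k[X] κ)) =
      (Algebra.lmul k κ (algebraMap k[X] κ Polynomial.X)).charpoly := by
  rw [charPoly_eq_charpoly]
  rfl

variable {k A B G F V : Type*} [Field k] [Fintype k] [CommRing A] [CommRing B] [Algebra k A]
  [Algebra k B] [Algebra A B] [IsScalarTower k A B] [Group G] [MulSemiringAction G B]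
  [SMulCommClass G A B] [Finite G] [Algebra.IsInvariant A B G] [Algebra k[X] A] [Algebra k[X] B]
  [IsScalarTower k k[X] A] [IsScalarTower k k[X] B] [IsScalarTower k[X] A B]
  [SMulCommClass G k[X] B]
  [Field F] [Algebra k F] [AddCommGroup V] [Module F V] [FiniteDimensional F V]

/-- The local identity for `B / pB`, at a maximal ideal `P` of `B` above `p` with a Frobenius
element `σ`. -/
theorem aeval_charPoly_lie_div_carlitz (p : Ideal A) [p.IsMaximal] (P : Ideal B) [P.IsMaximal]
    [P.LiesOver p] [Finite (B ⧸ P)] [Finite (B ⧸ p.map (algebraMap A B))] (σ : G)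
    (hσ : IsArithFrobAt A σ P) (ρ : Representation F G V) (U : Submodule F V)
    (hU : ∀ v, v ∈ U ↔ ∀ g ∈ P.inertia G, ρ g v = v) (φ : Module.End F U)
    (hφ : ∀ u, (φ u : V) = ρ σ u) (n : ℕ) [NeZero n] {E : Type*} [Field E] [Algebra F E] {x : E}
    (hx : ∀ P : F[X], P.Monic → Polynomial.aeval x P ≠ 0) :
    Polynomial.aeval x (charPoly
        (balancedTensorAction k (dualRight ρ) (lie k n (B ⧸ p.map (algebraMap A B)))
          (lie_smul k n _))) /
      Polynomial.aeval x (charPoly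
        (balancedTensorAction k (dualRight ρ) (carlitz k n (B ⧸ p.map (algebraMap A B)))
          (carlitz_smul k n _))) =
      (LinearMap.det (LinearMap.id - ((Polynomial.aeval x
        ((charPoly ((Algebra.lsmul k k (A ⧸ p)).comp
          (IsScalarTower.toAlgHom k k[X] (A ⧸ p)))).map (algebraMap k F))) ^ n)⁻¹ •
        φ.baseChange E))⁻¹ := by
  let : Field (A ⧸ p) := Ideal.Quotient.field p
  let : Field (B ⧸ P) := Ideal.Quotient.field P
  have : Finite (A ⧸ p) := Finite.of_injective _ (algebraMap (A ⧸ p) (B ⧸ P)).injective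
  let : Module k V := Module.compHom V (algebraMap k F)
  have : IsScalarTower k F V := ⟨fun a b v => by
    rw [Algebra.smul_def, mul_smul]
    rfl⟩
  let : Algebra (A ⧸ p) (B ⧸ p.map (algebraMap A B)) :=
    Ideal.Quotient.algebraQuotientOfLEComap Ideal.le_comap_map
  have : IsScalarTower k (A ⧸ p) (B ⧸ p.map (algebraMap A B)) := .of_algebraMap_eq fun x =>
    congrArg (Ideal.Quotient.mk _) (IsScalarTower.algebraMap_apply k A B x)
  have : SMulCommClass G k (B ⧸ p.map (algebraMap A B)) := ⟨fun g a x => by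
    rw [← IsScalarTower.algebraMap_smul k[X] a x, smul_comm, IsScalarTower.algebraMap_smul]⟩
  have h := aeval_charPoly_carlitz_eq_mul_det n (residueData (k := k) p P σ hσ) hU φ hφ
    (z := algebraMap k[X] (A ⧸ p) Polynomial.X)
    (congrArg (Ideal.Quotient.mk _) (IsScalarTower.algebraMap_apply k[X] A B Polynomial.X).symm) hx
  have h0 := hx (charPoly (balancedTensorAction k (dualRight ρ)
      (lie k n (B ⧸ p.map (algebraMap A B))) (lie_smul k n _))) (by
    rw [charPoly_eq_charpoly]
    exact LinearMap.charpoly_monic _)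
  rw [charPoly_lsmul, h]
  exact div_mul_cancel_left₀ h0 _

end LocalFactor

section LocalRatio

theorem injective_algebraMap_polynomial {k K : Type*} [Field k] [Field K] [Algebra (RatFunc k) K]
    [Algebra k[X] K] [IsScalarTower k[X] (RatFunc k) K] :
    Function.Injective (algebraMap k[X] K) := by
  rw [IsScalarTower.algebraMap_eq k[X] (RatFunc k) K]
  exact (algebraMap (RatFunc k) K).injective.comp (IsFractionRing.injective k[X] (RatFunc k))

variable {k K L F V : Type*} [Field k] [Fintype k] [Field K] [Field L] [Field F]
    [Algebra (RatFunc k) K] [FiniteDimensional (RatFunc k) K]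
    [Algebra k[X] K] [IsScalarTower k[X] (RatFunc k) K] [Algebra K L] [FiniteDimensional K L]
    [Algebra k[X] L] [IsScalarTower k[X] K L] [Algebra k F] [AddCommGroup V] [Module F V]

theorem finite_residueField_of_maximalSpectrum (p : MaximalSpectrum (IntClosure k K)) :
    Finite (ResidueField p) :=
  have := hasFiniteQuotients_intClosure (k := k) (L := K)
  Ring.HasFiniteQuotients.finiteQuotient
    (ne_bot_of_maximalSpectrum p injective_algebraMap_polynomial)

theorem finite_reduction (p : MaximalSpectrum (IntClosure k K)) : Finite (Reduction L p) := by
  let : Algebra (RatFunc k) L := ((algebraMap K L).comp (algebraMap (RatFunc k) K)).toAlgebra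
  have : IsScalarTower (RatFunc k) K L := .of_algebraMap_eq fun _ => rfl
  have : IsScalarTower k[X] (RatFunc k) L := .of_algebraMap_eq fun x => by
    rw [IsScalarTower.algebraMap_apply k[X] K L, IsScalarTower.algebraMap_apply k[X] (RatFunc k) K]
    rfl
  have : FiniteDimensional (RatFunc k) L := FiniteDimensional.trans _ K L
  have := hasFiniteQuotients_intClosure (k := k) (L := L)
  refine Ring.HasFiniteQuotients.finiteQuotient fun h => ?_
  refine ne_bot_of_maximalSpectrum p injective_algebraMap_polynomial
    ((Ideal.map_eq_bot_iff_of_injective fun x y hxy => ?_).mp h)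
  exact Subtype.ext ((algebraMap K L).injective (congrArg Subtype.val hxy))

variable [Algebra k K] [IsScalarTower k k[X] K]

instance free_residueField (p : MaximalSpectrum (IntClosure k K)) :
    Module.Free k (ResidueField p) := Module.Free.of_divisionRing _ _

instance moduleFinite_residueField (p : MaximalSpectrum (IntClosure k K)) :
    Module.Finite k (ResidueField p) :=
  have := finite_residueField_of_maximalSpectrum p
  Module.Finite.of_finite

/-- Only finitely many maximal ideals of `𝒪_K` have bounded residue degree. -/
theorem finite_setOf_finrank_residueField_le (N : ℕ) :
    {p : MaximalSpectrum (IntClosure k K) | Module.finrank k (ResidueField p) ≤ N}.Finite := by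
  have := hasFiniteQuotients_intClosure (k := k) (L := K)
  refine ((Ring.HasFiniteQuotients.finite_cardQuot_le (R := IntClosure k K)
    (Fintype.card k ^ N)).preimage
      (Function.Injective.injOn fun _ _ => MaximalSpectrum.ext)).subset fun p hp => ?_
  rw [Set.mem_preimage, Set.mem_ofPred, Submodule.cardQuot_apply]
  refine (Module.natCard_eq_pow_finrank (K := k) (V := ResidueField p)).trans_le ?_
  rw [Nat.card_eq_fintype_card]
  exact Nat.pow_le_pow_right Fintype.card_pos hp

theorem finrank_residueField_pos (p : MaximalSpectrum (IntClosure k K)) :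
    0 < Module.finrank k (ResidueField p) := by
  have : Nontrivial (ResidueField p) := Ideal.Quotient.nontrivial_iff.mpr p.isMaximal.ne_top
  exact Module.finrank_pos

theorem residueCharPoly_eq (p : MaximalSpectrum (IntClosure k K)) :
    residueCharPoly F p = ((Algebra.lmul k (ResidueField p)
      (algebraMap k[X] (ResidueField p) Polynomial.X)).charpoly).map (algebraMap k F) := by
  exact congrArg (Polynomial.map (algebraMap k F)) (charPoly_lsmul (ResidueField p))

theorem residueCharPoly_monic (p : MaximalSpectrum (IntClosure k K)) :
    (residueCharPoly F p).Monic := by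
  rw [residueCharPoly_eq]
  exact (LinearMap.charpoly_monic _).map _

theorem natDegree_residueCharPoly (p : MaximalSpectrum (IntClosure k K)) :
    (residueCharPoly F p).natDegree = Module.finrank k (ResidueField p) := by
  rw [residueCharPoly_eq, (LinearMap.charpoly_monic _).natDegree_map, LinearMap.charpoly_natDegree]

variable [Algebra k L] [IsScalarTower k k[X] L] [IsGalois K L] [FiniteDimensional F V]

/-- The local ratio at `p` is the Euler factor at `p`, for every choice of a prime and of a
Frobenius element above `p`. -/
theorem localRatio_eq_eulerFactor (hx : ∀ P : F[X], P.Monic → toLaurent F P ≠ 0)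
    (ρ : Representation F Gal(L/K) V) (n : ℕ) [NeZero n]
    {p : MaximalSpectrum (IntClosure k K)} (c : FrobeniusAt L p) :
    localRatio ρ n p = eulerFactor ρ n c := by
  have := p.isMaximal
  have := c.isPrime
  have := c.liesOver
  have : c.P.IsMaximal := Ideal.IsMaximal.of_liesOver_isMaximal c.P p.asIdeal
  have := finite_residueField K c.P
  have := finite_reduction (L := L) p
  exact aeval_charPoly_lie_div_carlitz (k := k) p.asIdeal c.P c.frob c.isFrob ρ
    (inertiaInvariants ρ c) (mem_inertiaInvariants ρ c) (frobOnInvariants ρ c) (fun u => rfl) n hx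

end LocalRatio

/-! ### Infinite products of power series in the field of Laurent series -/

section Laurent

variable {F : Type*} [Field F]

open scoped Topology in
/-- The power series congruent to `G` modulo high powers of the variable are close to `G`. -/
theorem exists_forall_X_pow_dvd_sub_mem (G : PowerSeries F) {U : Set (LaurentSeries F)}
    (hU : U ∈ 𝓝 (G : LaurentSeries F)) : ∃ N : ℕ, ∀ g : PowerSeries F,
      PowerSeries.X ^ N ∣ g - G → (g : LaurentSeries F) ∈ U := by
  obtain ⟨γ, hγ⟩ := Valued.mem_nhds.mp hU
  set δ := MonoidWithZeroHom.ValueGroup₀.embedding γ.1 with hδ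
  have hδ0 : δ ≠ 0 := by simp [hδ]
  refine ⟨(1 - WithZero.log δ).toNat, fun g hg => hγ ?_⟩
  rw [Set.mem_ofPred, Valued.v.restrict_lt_iff_lt_embedding, ← map_sub]
  refine ((LaurentSeries.intValuation_le_iff_coeff_lt_eq_zero F _).mpr
    (PowerSeries.X_pow_dvd_iff.mp hg)).trans_lt ?_
  rw [← WithZero.lt_log_iff_exp_lt hδ0]
  have := Int.self_le_toNat (1 - WithZero.log δ)
  lia

variable {ι : Type*}

/-- A product of power series `g i` converges in the field of Laurent series if, for every `N`, all
but finitely many `g i` are congruent to `1` modulo the power `N + 1` of the variable. -/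
theorem exists_hasProd_powerSeries (g : ι → PowerSeries F) (m : ι → ℕ) (hm : ∀ i, 0 < m i)
    (hfin : ∀ N, {i | m i ≤ N}.Finite) (hg : ∀ i, PowerSeries.X ^ m i ∣ g i - 1) :
    ∃ G : PowerSeries F, PowerSeries.constantCoeff G = 1 ∧
      HasProd (fun i => (g i : LaurentSeries F)) (G : LaurentSeries F) := by
  classical
  let S (N : ℕ) : Finset ι := (hfin N).toFinset
  have hS {N : ℕ} {i : ι} : i ∈ S N ↔ m i ≤ N := by simp [S]
  have key (N : ℕ) (s : Finset ι) (hs : S N ⊆ s) :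
      PowerSeries.X ^ (N + 1) ∣ ∏ i ∈ s, g i - ∏ i ∈ S N, g i := by
    rw [← Finset.prod_sdiff hs, ← sub_one_mul]
    refine Dvd.dvd.mul_right ?_ _
    refine Finset.prod_induction _ (fun f => PowerSeries.X ^ (N + 1) ∣ f - 1)
      (fun a b ha hb => ?_) (by simp) fun i hi => ?_
    · rw [show a * b - 1 = a * (b - 1) + (a - 1) by ring]
      exact dvd_add (hb.mul_left _) ha
    · rw [Finset.mem_sdiff, hS, not_le] at hi
      exact (pow_dvd_pow _ hi.2).trans (hg i)
  let G : PowerSeries F := PowerSeries.mk fun N => PowerSeries.coeff N (∏ i ∈ S N, g i)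
  have hG (N : ℕ) : PowerSeries.X ^ (N + 1) ∣ ∏ i ∈ S N, g i - G := by
    refine PowerSeries.X_pow_dvd_iff.mpr fun j hj => ?_
    rw [map_sub, PowerSeries.coeff_mk, ← map_sub]
    exact PowerSeries.X_pow_dvd_iff.mp (key j (S N) fun i hi => hS.mpr
      ((hS.mp hi).trans (by lia))) j (by lia)
  refine ⟨G, ?_, fun U hU => ?_⟩
  · rw [← PowerSeries.coeff_zero_eq_constantCoeff_apply, PowerSeries.coeff_mk,
      Finset.eq_empty_of_forall_notMem (s := S 0) fun i hi => (hm i).ne' (by simpa using hS.mp hi)]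
    simp
  · obtain ⟨N, hN⟩ := exists_forall_X_pow_dvd_sub_mem G hU
    refine Filter.mem_map.mpr (Filter.mem_of_superset (Filter.mem_atTop (S N)) fun s hs => ?_)
    rw [Set.mem_preimage, ← map_prod]
    refine hN _ ((pow_dvd_pow _ N.le_succ).trans ?_)
    have := dvd_add (key N s hs) (hG N)
    rwa [sub_add_sub_cancel] at this

theorem aeval_coe_powerSeries (w : PowerSeries F) (Q : F[X]) :
    Polynomial.aeval (w : LaurentSeries F) Q = ((Polynomial.aeval w Q : PowerSeries F) :
      LaurentSeries F) := by
  have h : algebraMap F (LaurentSeries F) =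
      (HahnSeries.ofPowerSeries ℤ F).comp (algebraMap F (PowerSeries F)) :=
    RingHom.ext fun a => by
      simp [RingHom.algebraMap_toAlgebra]
  rw [Polynomial.aeval_def, Polynomial.aeval_def, Polynomial.hom_eval₂, h]

/-- A monic polynomial of degree `d` in `t` is `t ^ d` times a power series in `t⁻¹` with constant
coefficient `1`. -/
theorem exists_toLaurent_mul_X_pow {P : F[X]} (hP : P.Monic) :
    ∃ u : PowerSeries F, PowerSeries.constantCoeff u = 1 ∧
      toLaurent F P * ((PowerSeries.X ^ P.natDegree : PowerSeries F) : LaurentSeries F) = u := by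
  have hX : (HahnSeries.single (-1 : ℤ) (1 : F) : LaurentSeries F) *
      ((PowerSeries.X : PowerSeries F) : LaurentSeries F) = 1 := by
    simp
  let : Invertible (HahnSeries.single (-1 : ℤ) (1 : F) : LaurentSeries F) :=
    ⟨_, (mul_comm _ _).trans hX, hX⟩
  refine ⟨Polynomial.aeval (PowerSeries.X : PowerSeries F) P.reverse, ?_, ?_⟩
  · rw [Polynomial.aeval_def, Polynomial.hom_eval₂, PowerSeries.constantCoeff_X,
      Polynomial.eval₂_at_zero]
    rw [Polynomial.coeff_zero_reverse, hP.leadingCoeff, map_one]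
  · rw [toLaurent, Polynomial.aeval_def, ← Polynomial.eval₂_reverse_mul_pow, mul_assoc, map_pow,
      ← mul_pow, hX, one_pow, mul_one]
    exact aeval_coe_powerSeries _ _

theorem toLaurent_ne_zero {P : F[X]} (hP : P.Monic) : toLaurent F P ≠ 0 := by
  obtain ⟨u, hu, h⟩ := exists_toLaurent_mul_X_pow hP
  intro h0
  rw [h0, zero_mul] at h
  have : u = 0 := HahnSeries.ofPowerSeries_injective (h.symm.trans (map_zero _).symm)
  simp [this] at hu

/-- `P⁻¹` is divisible by the power of `t⁻¹` with exponent the degree of `P`. -/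
theorem exists_inv_toLaurent {P : F[X]} (hP : P.Monic) :
    ∃ w : PowerSeries F, PowerSeries.X ^ P.natDegree ∣ w ∧
      (toLaurent F P)⁻¹ = (w : LaurentSeries F) := by
  obtain ⟨u, hu, h⟩ := exists_toLaurent_mul_X_pow hP
  refine ⟨PowerSeries.X ^ P.natDegree * u⁻¹, dvd_mul_right _ _, inv_eq_of_mul_eq_one_right ?_⟩
  rw [map_mul, ← mul_assoc, h, ← map_mul, PowerSeries.mul_inv_cancel _ (by simp [hu]), map_one]

/-- The inverse of a characteristic polynomial, evaluated at a power series divisible by `t ^ (-m)`,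
is congruent to `1` modulo `t ^ (-m)`. -/
theorem exists_inv_det_one_sub_smul {U : Type*} [AddCommGroup U] [Module F U]
    [FiniteDimensional F U] (φ : Module.End F U) {m : ℕ} (hm : 0 < m) {w : PowerSeries F}
    (hw : PowerSeries.X ^ m ∣ w) {c : LaurentSeries F} (hc : c = (w : LaurentSeries F)) :
    ∃ g : PowerSeries F, PowerSeries.X ^ m ∣ g - 1 ∧
      (LinearMap.det (LinearMap.id - c • φ.baseChange (LaurentSeries F)))⁻¹ =
        (g : LaurentSeries F) := by
  set h : PowerSeries F := Polynomial.aeval w φ.charpoly.reverse with hh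
  have h1 : PowerSeries.X ^ m ∣ h - 1 := by
    have := Polynomial.sub_dvd_eval_sub w 0 (φ.charpoly.reverse.map (algebraMap F (PowerSeries F)))
    rw [sub_zero, Polynomial.eval_map_algebraMap, Polynomial.eval_map_algebraMap,
      ← Polynomial.coeff_zero_eq_aeval_zero', reverse_charpoly_coeff_zero, map_one] at this
    exact hw.trans this
  have h2 : PowerSeries.constantCoeff h = 1 := by
    have := PowerSeries.X_dvd_iff.mp ((dvd_pow_self _ hm.ne').trans h1)
    rwa [map_sub, map_one, sub_eq_zero] at this
  have h3 : h * h⁻¹ = 1 := PowerSeries.mul_inv_cancel _ (by simp [h2])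
  refine ⟨h⁻¹, ?_, inv_eq_of_mul_eq_one_right ?_⟩
  · rw [show h⁻¹ - 1 = (h - 1) * -h⁻¹ by linear_combination h3]
    exact h1.mul_right _
  · refine (congrArg (· * _) (det_one_sub_smul_baseChange _ φ c)).trans ?_
    rw [hc, aeval_coe_powerSeries, ← hh, ← map_mul, h3, map_one]

end Laurent

/-! ### Convergence of the Euler product -/

section EulerFactor

variable {k K L F V : Type*} [Field k] [Fintype k] [Field K] [Field L] [Field F]
    [Algebra (RatFunc k) K] [FiniteDimensional (RatFunc k) K]
    [Algebra k K] [Algebra k[X] K] [IsScalarTower k k[X] K] [IsScalarTower k[X] (RatFunc k) K]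
    [Algebra K L] [Algebra k[X] L] [IsScalarTower k[X] K L]
    [Algebra k F] [AddCommGroup V] [Module F V] [FiniteDimensional F V]

/-- The Euler factor at `p` is a power series in `t⁻¹`, congruent to `1` modulo the power whose
exponent is the residue degree of `p`. -/
theorem exists_eulerFactor_eq (ρ : Representation F Gal(L/K) V) (n : ℕ) [NeZero n]
    {p : MaximalSpectrum (IntClosure k K)} (c : FrobeniusAt L p) :
    ∃ g : PowerSeries F, PowerSeries.X ^ Module.finrank k (ResidueField p) ∣ g - 1 ∧
      eulerFactor ρ n c = (g : LaurentSeries F) := by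
  obtain ⟨w, hw, h⟩ := exists_inv_toLaurent ((residueCharPoly_monic (F := F) p).pow n)
  rw [(residueCharPoly_monic p).natDegree_pow, natDegree_residueCharPoly] at hw
  rw [map_pow] at h
  exact exists_inv_det_one_sub_smul (frobOnInvariants ρ c) (finrank_residueField_pos p)
    ((pow_dvd_pow _ (Nat.le_mul_of_pos_left _ (NeZero.pos n))).trans hw) h

end EulerFactor

theorem finite_of_finiteDimensional (k : Type*) {F M : Type*} [Field k] [Finite k] [Field F]
    [Algebra k F] [FiniteDimensional k F] [AddCommGroup M] [Module F M] [Module.Finite F M] :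
    Finite M :=
  have : Finite F := Module.finite_of_finite k
  Module.finite_of_finite F

theorem finite_balancedTensor_dualRight {k F V G R : Type*} [Field k] [Finite k] [Field F]
    [Algebra k F] [FiniteDimensional k F] [Group G] [AddCommGroup V] [Module F V]
    [FiniteDimensional F V] (ρ : Representation F G V) [AddCommGroup R] [Module k R] [Finite R]
    [DistribMulAction G R] (n : ℕ) : Finite (BalancedTensor k (dualRight ρ) (Fin n → R)) :=
  have : Module.Finite k R := Module.Finite.of_finite
  finite_of_finiteDimensional k (F := F)

end CarlitzArtin

end

theorem lemma1p4 {k K L F V : Type*} [Field k] [Fintype k] [Field K] [Field L] [Field F]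
    [Algebra (RatFunc k) K] [FiniteDimensional (RatFunc k) K]
    [Algebra k K] [Algebra k[X] K] [IsScalarTower k k[X] K] [IsScalarTower k[X] (RatFunc k) K]
    [Algebra K L] [FiniteDimensional K L] [IsGalois K L]
    [Algebra k L] [Algebra k[X] L] [IsScalarTower k k[X] L] [IsScalarTower k[X] K L]
    [Algebra k F] [FiniteDimensional k F]
    [AddCommGroup V] [Module F V] [FiniteDimensional F V]
    (ρ : Representation F Gal(L/K) V) (n : ℕ) [NeZero n]
    (c : ∀ p : MaximalSpectrum (CarlitzArtin.IntClosure k K), CarlitzArtin.FrobeniusAt L p) :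
    (∀ p : MaximalSpectrum (CarlitzArtin.IntClosure k K),
      Finite (CarlitzArtin.BalancedTensor k (CarlitzArtin.dualRight ρ)
        (Fin n → CarlitzArtin.Reduction L p))) ∧
    Multipliable (fun p : MaximalSpectrum (CarlitzArtin.IntClosure k K) =>
      CarlitzArtin.eulerFactor ρ n (c p)) ∧
    HasProd (fun p : MaximalSpectrum (CarlitzArtin.IntClosure k K) =>
      CarlitzArtin.localRatio ρ n p) (CarlitzArtin.artinLValue ρ n c) ∧
    ∃ f : PowerSeries F, PowerSeries.constantCoeff f = 1 ∧
      (f : LaurentSeries F) = CarlitzArtin.artinLValue ρ n c := by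
  choose g hg hgc using fun p => CarlitzArtin.exists_eulerFactor_eq ρ n (c p)
  obtain ⟨G, hG, h⟩ := CarlitzArtin.exists_hasProd_powerSeries g
    (fun p => Module.finrank k (CarlitzArtin.ResidueField p))
    CarlitzArtin.finrank_residueField_pos CarlitzArtin.finite_setOf_finrank_residueField_le hg
  simp only [← hgc] at h
  have hL : CarlitzArtin.artinLValue ρ n c = G := h.tprod_eq
  refine ⟨fun p => ?_, h.multipliable, ?_, G, hG, hL.symm⟩
  · have := CarlitzArtin.finite_reduction (L := L) p
    exact CarlitzArtin.finite_balancedTensor_dualRight ρ n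
  · rw [hL]
    simpa only [CarlitzArtin.localRatio_eq_eulerFactor
      (fun _ => CarlitzArtin.toLaurent_ne_zero) ρ n (c _)] using h
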